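/- Let $p\ge 1$, $0<\alpha_1<1$, $\alpha_2:=1-\alpha_1$, let $\mu_1\ne\mu_2$ be vectors in $\mathbb{R}^p$ and let $\Sigma\in\mathbb{R}^{p\times p}$ be symmetric positive definite. Let $(x_1,y_1),(x_2,y_2),\dots$ be independent copies of a pair $(x,y)$ with values in $\mathbb{R}^p\times\{0,1\}$ such that $$y\sim\mathrm{Ber}(\alpha_1),\qquad x\mid y\sim\mathcal N_p\{y\mu_1+(1-y)\mu_2,\ \Sigma\}.$$ Put $$\bar x_{n1}:=\frac{\sum_{i=1}^n y_i x_i}{\sum_{i=1}^n y_i},\qquad \bar x_{n2}:=\frac{\sum_{i=1}^n(1-y_i)x_i}{\sum_{i=1}^n(1-y_i)},$$ $$S_n:=\frac1{n-2}\Big\{\sum_{i=1}^n y_i(x_i-\bar x_{n1})(x_i-\bar x_{n1})'+\sum_{i=1}^n(1-y_i)(x_i-\bar x_{n2})(x_i-\bar x_{n2})'\Big\},$$ $w_n:=S_n^{-1}(\bar x_{n2}-\bar x_{n1})$ and $\theta:=\Sigma^{-1}(\mu_2-\mu_1)$. (Reciprocals of $0$ and inverses of singular matrices are taken to be $0$;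 the event where this convention is needed has probability tending to $0$ as $n\to\infty$.) Then, as $n\to\infty$, $$\sqrt n\left(\frac{w_n}{\|w_n\|}-\frac{\theta}{\|\theta\|}\right)\rightsquigarrow\mathcal N_p(0,\Psi_U),\qquad \Psi_U:=\frac{1+\beta\tau}{\|\theta\|^2\beta}\Big(I_p-\frac{\theta\theta'}{\|\theta\|^2}\Big)\Sigma^{-1}\Big(I_p-\frac{\theta\theta'}{\|\theta\|^2}\Big),$$ where $\beta:=\alpha_1\alpha_2$, $\tau:=(\mu_2-\mu_1)'\Sigma^{-1}(\mu_2-\mu_1)$, $\|\cdot\|$ is the Euclidean norm and $\rightsquigarrow$ denotes convergence in distribution. -/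

import Mathlib

open MeasureTheory ProbabilityTheory Filter Matrix

namespace LDA

noncomputable section

open scoped MatrixOrder

/-- The conditional law of `x` given `y`: the Gaussian `N_p(y μ₁ + (1 - y) μ₂, S)`,
as a Markov kernel in the label `y`. -/
def classKernel {p : ℕ} (μ₁ μ₂ : EuclideanSpace ℝ (Fin p)) (S : Matrix (Fin p) (Fin p) ℝ) :
    Kernel ℝ (EuclideanSpace ℝ (Fin p)) where
  toFun y := multivariateGaussian (y • μ₁ + (1 - y) • μ₂) S
  measurable' := by
    refine Measure.measurable_of_measurable_coe _ fun s hs ↦ ?_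
    have h (y : ℝ) : multivariateGaussian (y • μ₁ + (1 - y) • μ₂) S s =
        stdGaussian (EuclideanSpace ℝ (Fin p))
          (Prod.mk y ⁻¹' {q : ℝ × EuclideanSpace ℝ (Fin p) | (q.1 • μ₁ + (1 - q.1) • μ₂) +
            toEuclideanCLM (𝕜 := ℝ) (CFC.sqrt S) q.2 ∈ s}) := by
      rw [multivariateGaussian, Measure.map_apply (by fun_prop) hs]
      rfl
    simp_rw [h]
    refine measurable_measure_prodMk_left (ν := stdGaussian (EuclideanSpace ℝ (Fin p)))
      (s := {q : ℝ × EuclideanSpace ℝ (Fin p) | (q.1 • μ₁ + (1 - q.1) • μ₂) +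
        toEuclideanCLM (𝕜 := ℝ) (CFC.sqrt S) q.2 ∈ s}) ?_
    exact (by fun_prop : Measurable fun q : ℝ × EuclideanSpace ℝ (Fin p) ↦
      (q.1 • μ₁ + (1 - q.1) • μ₂) + toEuclideanCLM (𝕜 := ℝ) (CFC.sqrt S) q.2) hs

instance {p : ℕ} (μ₁ μ₂ : EuclideanSpace ℝ (Fin p)) (S : Matrix (Fin p) (Fin p) ℝ) :
    IsMarkovKernel (classKernel μ₁ μ₂ S) where
  isProbabilityMeasure y :=
    inferInstanceAs (IsProbabilityMeasure (multivariateGaussian (y • μ₁ + (1 - y) • μ₂) S))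

/-- `(X i, Y i)`, `i = 0, 1, 2, …`, is an i.i.d. sequence of copies of the pair `(x, y)` with
`y ∼ Ber(α₁)` and `x ∣ y ∼ N_p(y μ₁ + (1 - y) μ₂, S)`. The label `1` has probability `α₁`. -/
structure IsSample {Ω : Type*} [MeasurableSpace Ω] (P : Measure Ω) {p : ℕ} (α₁ : unitInterval)
    (μ₁ μ₂ : EuclideanSpace ℝ (Fin p)) (S : Matrix (Fin p) (Fin p) ℝ)
    (X : ℕ → Ω → EuclideanSpace ℝ (Fin p)) (Y : ℕ → Ω → ℝ) : Prop where
  indep : iIndepFun (fun i ω ↦ (X i ω, Y i ω)) P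
  label : ∀ i, HasLaw (Y i) (bernoulliMeasure (1 : ℝ) 0 α₁) P
  cond : ∀ i, HasCondDistrib (X i) (Y i) (classKernel μ₁ μ₂ S) P

variable {p : ℕ}

/-- The matrix-vector product `A v`. -/
def mulVecE (A : Matrix (Fin p) (Fin p) ℝ) (v : EuclideanSpace ℝ (Fin p)) :
    EuclideanSpace ℝ (Fin p) :=
  WithLp.toLp 2 (A *ᵥ v.ofLp)

/-- The rank-one matrix `v v'`. -/
def outer (v : EuclideanSpace ℝ (Fin p)) : Matrix (Fin p) (Fin p) ℝ :=
  vecMulVec v.ofLp v.ofLp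

/-- Weighted mean of the first `n` observations; with the weights `y` this is the mean of the
first group, with the weights `1 - y` that of the second. -/
def weightedMean (n : ℕ) (x : ℕ → EuclideanSpace ℝ (Fin p)) (w : ℕ → ℝ) :
    EuclideanSpace ℝ (Fin p) :=
  (∑ i ∈ Finset.range n, w i)⁻¹ • ∑ i ∈ Finset.range n, w i • x i

/-- The mean of the observations with label `1`. -/
def mean₁ (n : ℕ) (x : ℕ → EuclideanSpace ℝ (Fin p)) (y : ℕ → ℝ) : EuclideanSpace ℝ (Fin p) :=
  weightedMean n x y

/-- The mean of the observations with label `0`. -/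
def mean₂ (n : ℕ) (x : ℕ → EuclideanSpace ℝ (Fin p)) (y : ℕ → ℝ) : EuclideanSpace ℝ (Fin p) :=
  weightedMean n x (fun i ↦ 1 - y i)

/-- The pooled within-group sample covariance matrix `S_n`. -/
def pooledCov (n : ℕ) (x : ℕ → EuclideanSpace ℝ (Fin p)) (y : ℕ → ℝ) :
    Matrix (Fin p) (Fin p) ℝ :=
  ((n : ℝ) - 2)⁻¹ • (∑ i ∈ Finset.range n, y i • outer (x i - mean₁ n x y) +
    ∑ i ∈ Finset.range n, (1 - y i) • outer (x i - mean₂ n x y))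

/-- The unit vector `v / ‖v‖` (and `0` if `v = 0`). -/
def unit (v : EuclideanSpace ℝ (Fin p)) : EuclideanSpace ℝ (Fin p) :=
  ‖v‖⁻¹ • v

/-- The LDA estimator `w_n = S_n⁻¹ (x̄_{n2} - x̄_{n1})`. -/
def ldaEstimator (n : ℕ) (x : ℕ → EuclideanSpace ℝ (Fin p)) (y : ℕ → ℝ) :
    EuclideanSpace ℝ (Fin p) :=
  mulVecE (pooledCov n x y)⁻¹ (mean₂ n x y - mean₁ n x y)

/-- The discriminant direction `θ = S⁻¹ (μ₂ - μ₁)`. -/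
def discriminant (μ₁ μ₂ : EuclideanSpace ℝ (Fin p)) (S : Matrix (Fin p) (Fin p) ℝ) :
    EuclideanSpace ℝ (Fin p) :=
  mulVecE S⁻¹ (μ₂ - μ₁)

/-- The squared Mahalanobis distance `τ = (μ₂ - μ₁)' S⁻¹ (μ₂ - μ₁)`. -/
def mahalanobisSq (μ₁ μ₂ : EuclideanSpace ℝ (Fin p)) (S : Matrix (Fin p) (Fin p) ℝ) : ℝ :=
  (μ₂ - μ₁).ofLp ⬝ᵥ (S⁻¹ *ᵥ (μ₂ - μ₁).ofLp)

/-- The matrix `I - v v' / ‖v‖²`. -/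
def projCompl (v : EuclideanSpace ℝ (Fin p)) : Matrix (Fin p) (Fin p) ℝ :=
  1 - (‖v‖ ^ 2)⁻¹ • outer v

/-- The limiting covariance matrix
`Ψ_U = (1 + β τ) / (‖θ‖² β) (I - θ θ' / ‖θ‖²) S⁻¹ (I - θ θ' / ‖θ‖²)`, `β = α₁ (1 - α₁)`. -/
def limitCov (α₁ : ℝ) (μ₁ μ₂ : EuclideanSpace ℝ (Fin p)) (S : Matrix (Fin p) (Fin p) ℝ) :
    Matrix (Fin p) (Fin p) ℝ :=
  ((1 + α₁ * (1 - α₁) * mahalanobisSq μ₁ μ₂ S) /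
      (‖discriminant μ₁ μ₂ S‖ ^ 2 * (α₁ * (1 - α₁)))) •
    (projCompl (discriminant μ₁ μ₂ S) * S⁻¹ * projCompl (discriminant μ₁ μ₂ S))

end

end LDA

open scoped Topology RealInnerProductSpace

/-! Write `x = y μ₁ + (1 - y) μ₂ + z`; then `z` is `N(0, S)` and independent of the label `y`
(`IsSample.hasLaw_center`). Since `w_n - θ = S_n⁻¹ (d_n - S_n θ)` with `d_n` the difference of the
class means, and `unit w - unit θ = L(w) (w - θ)` exactly (`unit_sub_unit`), the quantity of
interest is `L(w_n) S_n⁻¹ · √n (d_n - S_n θ)`.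

The last factor is a polynomial in scalar coefficients and in the normalised sum `V_n` of the i.i.d.
centred vectors `(y z, (1 - y) z, ⟪θ, z⟫ z - S θ)` (`sqrt_smul_unit_sub_unit`). The central limit
theorem makes `V_n` asymptotically Gaussian. The strong law makes the coefficients and `L(w_n)
S_n⁻¹` converge almost surely, the latter to `M = L(θ) S⁻¹`. Slutsky's theorem then gives a linear
image of the Gaussian limit, because the quadratic terms carry the factor `√n / (n - 2) → 0`.

For the covariance, put `s = M' t`. The functional of the limit in direction `t` has the variance of
`⟪s, z⟫ (c(y) - ⟪θ, z⟫)`, where `c(1) = -1/α₁` and `c(0) = 1/α₂`. As `L(θ) θ = 0`, also `M S θ = 0`,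
so `⟪s, z⟫` and `⟪θ, z⟫` are uncorrelated, hence independent. The variance factors as `s' S s · (E
c(y)² + θ' S θ) = s' S s · (1/β + τ)`, without fourth moments (`variance_inner_limitMap_score`). -/

namespace LDA

/-! ### Multivariate central limit theorem, by characteristic functions. -/

section CentralLimit

variable {Ω ι : Type*} [MeasurableSpace Ω] {P : Measure Ω} [IsProbabilityMeasure P] [Fintype ι]

/-- The covariance matrix of a random vector. -/
noncomputable def covMat (P : Measure Ω) (ξ : Ω → EuclideanSpace ℝ ι) : Matrix ι ι ℝ :=
  Matrix.of fun i j ↦ cov[fun ω ↦ ξ ω i, fun ω ↦ ξ ω j; P]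

lemma dotProduct_covMat_mulVec {ξ : Ω → EuclideanSpace ℝ ι} (hξ : MemLp ξ 2 P)
    (t : EuclideanSpace ℝ ι) :
    t.ofLp ⬝ᵥ covMat P ξ *ᵥ t.ofLp = Var[fun ω ↦ ⟪t, ξ ω⟫; P] := by
  have hi (i : ι) : MemLp (fun ω ↦ ξ ω i) 2 P :=
    (EuclideanSpace.proj (𝕜 := ℝ) i).comp_memLp' hξ
  have := covarianceBilin_apply_pi hi t t
  rw [covarianceBilin_self] at this
  · rw [variance_map (by fun_prop)] at this
    · change _ = Var[(fun u ↦ ⟪t, u⟫) ∘ fun ω ↦ ξ ω; P]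
      refine Eq.trans ?_ this.symm
      simp only [dotProduct, mulVec, covMat, Matrix.of_apply, Finset.mul_sum]
      refine Finset.sum_congr rfl fun i _ ↦ Finset.sum_congr rfl fun j _ ↦ by ring
    · exact hξ.aestronglyMeasurable.aemeasurable
  · exact (memLp_map_measure_iff (by fun_prop) hξ.aestronglyMeasurable.aemeasurable).2 hξ

lemma posSemidef_covMat {ξ : Ω → EuclideanSpace ℝ ι} (hξ : MemLp ξ 2 P) :
    (covMat P ξ).PosSemidef := by
  refine Matrix.PosSemidef.of_dotProduct_mulVec_nonneg ?_ fun x ↦ ?_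
  · ext i j
    simp [covMat, covariance_comm]
  · have := dotProduct_covMat_mulVec hξ (WithLp.toLp 2 x)
    simp only [star_trivial]
    rw [this]
    exact variance_nonneg _ _

/-- Only variances of linear functionals enter, so the entries of the covariance matrix of the score
never have to be computed. -/
lemma charFun_multivariateGaussian_covMat [DecidableEq ι] {ξ : Ω → EuclideanSpace ℝ ι} (hξ : MemLp ξ 2 P)
    (t : EuclideanSpace ℝ ι) :
    charFun (multivariateGaussian 0 (covMat P ξ)) t =
      Complex.exp (-(Var[fun ω ↦ ⟪t, ξ ω⟫; P] : ℂ) / 2) := by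
  rw [charFun_multivariateGaussian (posSemidef_covMat hξ), dotProduct_covMat_mulVec hξ]
  simp [neg_div]

/-- The **multivariate central limit theorem** for centred square-integrable random vectors. -/
theorem tendstoInDistribution_inv_sqrt_smul_sum [DecidableEq ι] {ξ : ℕ → Ω → EuclideanSpace ℝ ι}
    (hξ : MemLp (ξ 0) 2 P) (h0 : P[ξ 0] = 0) (hindep : iIndepFun ξ P)
    (hident : ∀ i, IdentDistrib (ξ i) (ξ 0) P P) :
    TendstoInDistribution (fun (n : ℕ) ω ↦ (√(n : ℝ))⁻¹ • ∑ k ∈ Finset.range n, ξ k ω) atTop id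
      (fun _ ↦ P) (multivariateGaussian 0 (covMat P (ξ 0))) where
  forall_aemeasurable n := by
    have := fun i ↦ (hident i).aemeasurable_fst
    fun_prop
  tendsto := by
    refine ProbabilityMeasure.tendsto_iff_tendsto_charFun.2 fun t ↦ ?_
    have hm (i : ℕ) : AEMeasurable (ξ i) P := (hident i).aemeasurable_fst
    have hlaw : HasLaw id (gaussianReal 0 Var[fun ω ↦ ⟪t, ξ 0 ω⟫; P].toNNReal)
        (gaussianReal 0 Var[fun ω ↦ ⟪t, ξ 0 ω⟫; P].toNNReal) := HasLaw.id
    have hint : Integrable (ξ 0) P := hξ.integrable (by norm_num)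
    have hclt := tendstoInDistribution_inv_sqrt_mul_sum_sub (P := P)
      (X := fun i ω ↦ ⟪t, ξ i ω⟫) hlaw (hξ.const_inner t)
      (hindep.comp (fun _ x ↦ ⟪t, x⟫) (by fun_prop))
      (fun i ↦ (hident i).comp (u := fun x ↦ ⟪t, x⟫) (by fun_prop))
    have hz : ∫ ω, ⟪t, ξ 0 ω⟫ ∂P = 0 := by
      rw [integral_inner hint, h0, inner_zero_right]
    -- Cramér–Wold: the characteristic function of the vector sum at `t` is that of its projection
    -- on `t` at `1`.
    have := ProbabilityMeasure.tendsto_iff_tendsto_charFun.1 hclt.tendsto 1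
    simp only [ProbabilityMeasure.coe_mk, Measure.map_id, hz, mul_zero, sub_zero] at this ⊢
    rw [charFun_multivariateGaussian_covMat hξ]
    rw [charFun_gaussianReal] at this
    simp only [Complex.ofReal_one, Complex.ofReal_zero, mul_zero, zero_mul, one_pow, mul_one,
      zero_sub, Real.coe_toNNReal _ (variance_nonneg _ _), ← neg_div] at this
    refine this.congr fun n ↦ ?_
    rw [charFun_apply, charFun_apply, integral_map, integral_map]
    · refine integral_congr_ae (Eventually.of_forall fun ω ↦ ?_)
      simp [inner_smul_left, sum_inner, real_inner_comm]
    · fun_prop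
    · fun_prop
    · fun_prop
    · fun_prop

/-- A linear image of the Gaussian vector with covariance `covMat P ξ` is determined by the
variances of the linear functionals of the image of `ξ`. -/
lemma map_multivariateGaussian_covMat {κ : Type*} [Fintype κ] [DecidableEq ι] [DecidableEq κ]
    {ξ : Ω → EuclideanSpace ℝ ι} (hξ : MemLp ξ 2 P)
    (A : EuclideanSpace ℝ ι →L[ℝ] EuclideanSpace ℝ κ) {Ψ : Matrix κ κ ℝ} (hΨ : Ψ.PosSemidef)
    (h : ∀ t : EuclideanSpace ℝ κ, Var[fun ω ↦ ⟪t, A (ξ ω)⟫; P] = t.ofLp ⬝ᵥ Ψ *ᵥ t.ofLp) :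
    (multivariateGaussian 0 (covMat P ξ)).map A = multivariateGaussian 0 Ψ := by
  refine Measure.ext_of_charFun (funext fun t ↦ ?_)
  have : charFun ((multivariateGaussian 0 (covMat P ξ)).map A) t =
      charFun (multivariateGaussian 0 (covMat P ξ)) (A.adjoint t) := by
    rw [charFun_apply, charFun_apply, integral_map (by fun_prop) (by fun_prop)]
    simp [ContinuousLinearMap.adjoint_inner_right]
  rw [this, charFun_multivariateGaussian_covMat hξ, charFun_multivariateGaussian hΨ, ← h]
  simp [ContinuousLinearMap.adjoint_inner_left, neg_div]

end CentralLimit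

/-! ### Integration over a Bernoulli label and an independent variable. -/

section BernoulliProd

variable {α : Type*} [MeasurableSpace α] {ν : Measure α} [IsProbabilityMeasure ν]
  {q : unitInterval} {f : ℝ × α → ℝ}

lemma bernoulliMeasure_prod : (bernoulliMeasure (1 : ℝ) 0 q).prod ν =
    unitInterval.toNNReal q • ν.map (Prod.mk 1) +
      unitInterval.toNNReal (unitInterval.symm q) • ν.map (Prod.mk 0) := by
  rw [bernoulliMeasure_def, Measure.add_prod, Measure.prod_smul_left, Measure.prod_smul_left,
    Measure.dirac_prod, Measure.dirac_prod]

lemma integrable_bernoulliMeasure_prod (hf : Measurable f)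
    (h₁ : Integrable (fun z ↦ f (1, z)) ν) (h₀ : Integrable (fun z ↦ f (0, z)) ν) :
    Integrable f ((bernoulliMeasure (1 : ℝ) 0 q).prod ν) := by
  rw [bernoulliMeasure_prod, integrable_add_measure]
  constructor
  · exact ((integrable_map_measure hf.aestronglyMeasurable (by fun_prop)).2
      h₁).smul_measure_nnreal
  · exact ((integrable_map_measure hf.aestronglyMeasurable (by fun_prop)).2
      h₀).smul_measure_nnreal

lemma integral_bernoulliMeasure_prod (hf : Measurable f)
    (h₁ : Integrable (fun z ↦ f (1, z)) ν) (h₀ : Integrable (fun z ↦ f (0, z)) ν) :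
    ∫ x, f x ∂((bernoulliMeasure (1 : ℝ) 0 q).prod ν) =
      (q : ℝ) * ∫ z, f (1, z) ∂ν + (1 - q : ℝ) * ∫ z, f (0, z) ∂ν := by
  rw [integral_prod _ (integrable_bernoulliMeasure_prod hf h₁ h₀), integral_bernoulliMeasure]
  simp

lemma memLp_two_bernoulliMeasure_prod (hf : Measurable f)
    (h₁ : MemLp (fun z ↦ f (1, z)) 2 ν) (h₀ : MemLp (fun z ↦ f (0, z)) 2 ν) :
    MemLp f 2 ((bernoulliMeasure (1 : ℝ) 0 q).prod ν) :=
  (memLp_two_iff_integrable_sq hf.aestronglyMeasurable).2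
    (integrable_bernoulliMeasure_prod (hf.pow_const 2) h₁.integrable_sq h₀.integrable_sq)

end BernoulliProd

variable {p : ℕ}

/-! ### Moments of linear functionals of a centred Gaussian vector. -/

section GaussianMoments

variable {S : Matrix (Fin p) (Fin p) ℝ}

lemma memLp_inner_multivariateGaussian (s : EuclideanSpace ℝ (Fin p)) (r : ENNReal) (hr : r ≠ ⊤) :
    MemLp (fun z ↦ ⟪s, z⟫) r (multivariateGaussian 0 S) :=
  (IsGaussian.memLp_id (multivariateGaussian 0 S) r hr).const_inner s

lemma integral_inner_multivariateGaussian (s : EuclideanSpace ℝ (Fin p)) :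
    ∫ z, ⟪s, z⟫ ∂(multivariateGaussian 0 S) = 0 := by
  have := integral_inner (𝕜 := ℝ) (μ := multivariateGaussian 0 S) IsGaussian.integrable_id s
  simpa using this

lemma covariance_inner_multivariateGaussian (hS : S.PosSemidef)
    (s t : EuclideanSpace ℝ (Fin p)) :
    cov[fun z ↦ ⟪s, z⟫, fun z ↦ ⟪t, z⟫; multivariateGaussian 0 S] =
      s.ofLp ⬝ᵥ S *ᵥ t.ofLp := by
  rw [← covarianceBilin_apply_eq_cov IsGaussian.memLp_two_id,
    covarianceBilin_multivariateGaussian hS]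

lemma integral_inner_mul_inner_multivariateGaussian (hS : S.PosSemidef)
    (s t : EuclideanSpace ℝ (Fin p)) :
    ∫ z, ⟪s, z⟫ * ⟪t, z⟫ ∂(multivariateGaussian 0 S) = s.ofLp ⬝ᵥ S *ᵥ t.ofLp := by
  rw [← covariance_inner_multivariateGaussian hS, covariance]
  simp [integral_inner_multivariateGaussian]

lemma memLp_inner_mul_inner_multivariateGaussian (s t : EuclideanSpace ℝ (Fin p)) :
    MemLp (fun z ↦ ⟪s, z⟫ * ⟪t, z⟫) 2 (multivariateGaussian 0 S) := by
  -- Hölder with `1/4 + 1/4 = 1/2`: a product of two functions in `L⁴` is in `L²`.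
  have : ENNReal.HolderTriple 4 4 2 := ⟨by
    rw [show (4 : ENNReal) = 2 * 2 by norm_num, ENNReal.mul_inv (by simp) (by simp), ← two_mul,
      ← mul_assoc, ENNReal.mul_inv_cancel (by simp) (by simp), one_mul]⟩
  exact (memLp_inner_multivariateGaussian t 4 (by simp)).mul'
    (memLp_inner_multivariateGaussian s 4 (by simp))

/-- The pair is a linear image of one Gaussian vector, hence jointly Gaussian, and then uncorrelated
means independent. -/
lemma indepFun_inner_multivariateGaussian (hS : S.PosSemidef) {s t : EuclideanSpace ℝ (Fin p)}
    (h : s.ofLp ⬝ᵥ S *ᵥ t.ofLp = 0) :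
    IndepFun (fun z ↦ ⟪s, z⟫) (fun z ↦ ⟪t, z⟫) (multivariateGaussian 0 S) := by
  refine HasGaussianLaw.indepFun_of_covariance_eq_zero ?_
    ((covariance_inner_multivariateGaussian hS s t).trans h)
  exact (IsGaussian.hasGaussianLaw_id (μ := multivariateGaussian 0 S)).map_fun
    ((innerSL ℝ s).prod (innerSL ℝ t))

/-- Second moment of `⟪s, z⟫ * (c - ⟪t, z⟫)` when `⟪s, z⟫` and `⟪t, z⟫` are uncorrelated. -/
lemma integral_sq_inner_mul_sub_multivariateGaussian (hS : S.PosSemidef)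
    {s t : EuclideanSpace ℝ (Fin p)} (h : s.ofLp ⬝ᵥ S *ᵥ t.ofLp = 0) (c : ℝ) :
    ∫ z, (⟪s, z⟫ * (c - ⟪t, z⟫)) ^ 2 ∂(multivariateGaussian 0 S) =
      (s.ofLp ⬝ᵥ S *ᵥ s.ofLp) * (c ^ 2 + t.ofLp ⬝ᵥ S *ᵥ t.ofLp) := by
  have hi := (indepFun_inner_multivariateGaussian hS h).integral_fun_comp_mul_comp
    (f := fun x ↦ x ^ 2) (g := fun x ↦ (c - x) ^ 2) (by fun_prop) (by fun_prop)
    (by fun_prop) (by fun_prop)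
  have h2 : ∫ z, (c - ⟪t, z⟫) ^ 2 ∂(multivariateGaussian 0 S) =
      c ^ 2 + t.ofLp ⬝ᵥ S *ᵥ t.ofLp := by
    have e (z : EuclideanSpace ℝ (Fin p)) :
        (c - ⟪t, z⟫) ^ 2 = c ^ 2 - (2 * c) * ⟪t, z⟫ + ⟪t, z⟫ * ⟪t, z⟫ := by ring
    have i1 : Integrable (fun z ↦ (2 * c) * ⟪t, z⟫) (multivariateGaussian 0 S) :=
      ((memLp_inner_multivariateGaussian t 1 (by simp)).integrable le_rfl).const_mul _
    have i2 : Integrable (fun z ↦ ⟪t, z⟫ * ⟪t, z⟫) (multivariateGaussian 0 S) :=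
      (memLp_inner_mul_inner_multivariateGaussian t t).integrable (by norm_num)
    simp_rw [e]
    rw [integral_add (by fun_prop) i2, integral_sub (integrable_const _) i1,
      integral_const_mul, integral_inner_multivariateGaussian,
      integral_inner_mul_inner_multivariateGaussian hS]
    simp
  have h1 : ∫ z, ⟪s, z⟫ ^ 2 ∂(multivariateGaussian 0 S) = s.ofLp ⬝ᵥ S *ᵥ s.ofLp := by
    simp_rw [pow_two, integral_inner_mul_inner_multivariateGaussian hS]
  simp_rw [mul_pow]
  rw [hi, h1, h2]

end GaussianMoments

/-! ### Centring at the class means, and the strong law. -/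

section Noise

variable {Ω : Type*} [MeasurableSpace Ω] {P : Measure Ω}
  {α₁ : unitInterval} {μ₁ μ₂ : EuclideanSpace ℝ (Fin p)} {S : Matrix (Fin p) (Fin p) ℝ}
  {X : ℕ → Ω → EuclideanSpace ℝ (Fin p)} {Y : ℕ → Ω → ℝ}

/-- The label together with the observation centred at its class mean. -/
noncomputable def center (μ₁ μ₂ : EuclideanSpace ℝ (Fin p)) (u : EuclideanSpace ℝ (Fin p) × ℝ) :
    ℝ × EuclideanSpace ℝ (Fin p) :=
  (u.2, u.1 - (u.2 • μ₁ + (1 - u.2) • μ₂))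

@[fun_prop]
lemma measurable_center : Measurable (center μ₁ μ₂) := by
  unfold center
  fun_prop

lemma map_classKernel_sub (y : ℝ) :
    (classKernel μ₁ μ₂ S y).map (fun x ↦ x - (y • μ₁ + (1 - y) • μ₂)) =
      multivariateGaussian 0 S := by
  change (multivariateGaussian (y • μ₁ + (1 - y) • μ₂) S).map _ = _
  unfold multivariateGaussian
  rw [Measure.map_map (by fun_prop) (by fun_prop)]
  congr 1
  ext x : 1
  simp

/-- The label and the centred observation are independent, and the latter is Gaussian. -/
lemma IsSample.hasLaw_center (h : IsSample P α₁ μ₁ μ₂ S X Y) (i : ℕ) :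
    HasLaw (fun ω ↦ center μ₁ μ₂ (X i ω, Y i ω))
      ((bernoulliMeasure (1 : ℝ) 0 α₁).prod (multivariateGaussian 0 S)) P := by
  have hl := (h.label i).prodMk_of_hasCondDistrib (h.cond i)
  have hm : Measurable fun u : ℝ × EuclideanSpace ℝ (Fin p) ↦ center μ₁ μ₂ (u.2, u.1) := by
    fun_prop
  refine ⟨hm.comp_aemeasurable hl.aemeasurable, ?_⟩
  have : P.map (fun ω ↦ center μ₁ μ₂ (X i ω, Y i ω)) =
      (P.map fun ω ↦ (Y i ω, X i ω)).map fun u ↦ center μ₁ μ₂ (u.2, u.1) := by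
    rw [AEMeasurable.map_map_of_aemeasurable hm.aemeasurable hl.aemeasurable]
    rfl
  rw [this, hl.map_eq]
  symm
  refine Measure.prod_eq fun s t hs ht ↦ ?_
  rw [Measure.map_apply hm (hs.prod ht), Measure.compProd_apply (hm (hs.prod ht))]
  -- The section at `y` of the preimage of the rectangle is a translate of `t` if `y ∈ s` and empty
  -- otherwise; the translation undoes the class mean.
  have e (y : ℝ) : classKernel μ₁ μ₂ S y
      (Prod.mk y ⁻¹' ((fun u ↦ center μ₁ μ₂ (u.2, u.1)) ⁻¹' (s ×ˢ t))) =
      s.indicator (fun _ ↦ multivariateGaussian 0 S t) y := by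
    by_cases hy : y ∈ s
    · rw [Set.indicator_of_mem hy, ← map_classKernel_sub (μ₁ := μ₁) (μ₂ := μ₂) y,
        Measure.map_apply (by fun_prop) ht]
      congr 1
      ext x
      simp [center, hy]
    · rw [Set.indicator_of_notMem hy]
      convert measure_empty (μ := classKernel μ₁ μ₂ S y)
      ext x
      simp [center, hy]
  simp_rw [e]
  rw [lintegral_indicator hs]
  simp [mul_comm]

lemma IsSample.iIndepFun_comp_center (h : IsSample P α₁ μ₁ μ₂ S X Y) {β : Type*}
    [MeasurableSpace β] {f : ℝ × EuclideanSpace ℝ (Fin p) → β} (hf : Measurable f) :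
    iIndepFun (fun i ω ↦ f (center μ₁ μ₂ (X i ω, Y i ω))) P :=
  h.indep.comp (fun _ u ↦ f (center μ₁ μ₂ u)) fun _ ↦ hf.comp measurable_center

lemma IsSample.identDistrib_comp_center (h : IsSample P α₁ μ₁ μ₂ S X Y) {β : Type*}
    [MeasurableSpace β] {f : ℝ × EuclideanSpace ℝ (Fin p) → β} (hf : Measurable f) (i : ℕ) :
    IdentDistrib (fun ω ↦ f (center μ₁ μ₂ (X i ω, Y i ω)))
      (fun ω ↦ f (center μ₁ μ₂ (X 0 ω, Y 0 ω))) P P :=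
  IdentDistrib.comp ⟨(h.hasLaw_center i).aemeasurable, (h.hasLaw_center 0).aemeasurable,
    (h.hasLaw_center i).map_eq.trans (h.hasLaw_center 0).map_eq.symm⟩ hf

/-- The strong law of large numbers for functions of the label and the centred observation. -/
lemma IsSample.ae_tendsto_average (h : IsSample P α₁ μ₁ μ₂ S X Y)
    {f : ℝ × EuclideanSpace ℝ (Fin p) → ℝ} (hf : Measurable f)
    (hi : Integrable f ((bernoulliMeasure (1 : ℝ) 0 α₁).prod (multivariateGaussian 0 S))) :
    ∀ᵐ ω ∂P, Tendsto
      (fun n : ℕ ↦ (n : ℝ)⁻¹ * ∑ i ∈ Finset.range n, f (center μ₁ μ₂ (X i ω, Y i ω))) atTop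
      (𝓝 (∫ u, f u ∂((bernoulliMeasure (1 : ℝ) 0 α₁).prod (multivariateGaussian 0 S)))) := by
  have hl := h.hasLaw_center 0
  rw [← hl.map_eq] at hi ⊢
  rw [integral_map hl.aemeasurable hf.aestronglyMeasurable]
  exact strong_law_ae (fun i ω ↦ f (center μ₁ μ₂ (X i ω, Y i ω)))
    (hi.comp_aemeasurable hl.aemeasurable)
    (fun i j hij ↦ (h.iIndepFun_comp_center hf).indepFun hij) (h.identDistrib_comp_center hf)

lemma IsSample.ae_label (h : IsSample P α₁ μ₁ μ₂ S X Y) :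
    ∀ᵐ ω ∂P, ∀ i, Y i ω = 1 ∨ Y i ω = 0 := by
  refine ae_all_iff.2 fun i ↦ ae_of_ae_map (p := fun y ↦ y = 1 ∨ y = 0)
    (h.label i).aemeasurable ?_
  have hm : MeasurableSet {y : ℝ | y = 1 ∨ y = 0} :=
    (measurableSet_singleton 1).union (measurableSet_singleton 0)
  rw [(h.label i).map_eq, ae_iff, ← Set.compl_ofPred,
    bernoulliMeasure_apply_of_notMem_of_notMem _ hm.compl] <;> simp

end Noise

/-! ### Matrix-vector algebra. -/

section Algebra

lemma mulVecE_apply (A : Matrix (Fin p) (Fin p) ℝ) (v : EuclideanSpace ℝ (Fin p)) (i : Fin p) :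
    mulVecE A v i = ∑ j, A i j * v j := rfl

lemma mulVecE_sub (A : Matrix (Fin p) (Fin p) ℝ) (v w : EuclideanSpace ℝ (Fin p)) :
    mulVecE A (v - w) = mulVecE A v - mulVecE A w := by
  simp [mulVecE, mulVec_sub]

lemma mulVecE_smul (A : Matrix (Fin p) (Fin p) ℝ) (c : ℝ) (v : EuclideanSpace ℝ (Fin p)) :
    mulVecE A (c • v) = c • mulVecE A v := by
  simp [mulVecE, mulVec_smul]

lemma sub_mulVecE (A B : Matrix (Fin p) (Fin p) ℝ) (v : EuclideanSpace ℝ (Fin p)) :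
    mulVecE (A - B) v = mulVecE A v - mulVecE B v := by
  simp [mulVecE, sub_mulVec]

lemma smul_mulVecE (c : ℝ) (A : Matrix (Fin p) (Fin p) ℝ) (v : EuclideanSpace ℝ (Fin p)) :
    mulVecE (c • A) v = c • mulVecE A v := by
  simp [mulVecE, smul_mulVec]

lemma sum_mulVecE {ι : Type*} (s : Finset ι) (A : ι → Matrix (Fin p) (Fin p) ℝ)
    (v : EuclideanSpace ℝ (Fin p)) : mulVecE (∑ i ∈ s, A i) v = ∑ i ∈ s, mulVecE (A i) v := by
  simp [mulVecE, sum_mulVec]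

lemma mulVecE_mulVecE (A B : Matrix (Fin p) (Fin p) ℝ) (v : EuclideanSpace ℝ (Fin p)) :
    mulVecE A (mulVecE B v) = mulVecE (A * B) v := by
  simp [mulVecE, mulVec_mulVec]

lemma one_mulVecE (v : EuclideanSpace ℝ (Fin p)) : mulVecE 1 v = v := by
  simp [mulVecE]

lemma vecMulVec_mulVecE (u v w : EuclideanSpace ℝ (Fin p)) :
    mulVecE (vecMulVec u.ofLp v.ofLp) w = ⟪v, w⟫ • u := by
  ext i
  simp [mulVecE_apply, vecMulVec_apply, PiLp.inner_apply, Finset.sum_mul]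
  exact Finset.sum_congr rfl fun _ _ ↦ by ring

lemma outer_mulVecE (v w : EuclideanSpace ℝ (Fin p)) : mulVecE (outer v) w = ⟪v, w⟫ • v :=
  vecMulVec_mulVecE v v w

lemma outer_apply (v : EuclideanSpace ℝ (Fin p)) (i j : Fin p) : outer v i j = v i * v j := rfl

lemma outer_smul (c : ℝ) (v : EuclideanSpace ℝ (Fin p)) : outer (c • v) = c ^ 2 • outer v := by
  ext i j
  simp [outer_apply]
  ring

end Algebra

/-! ### Weighted means and scatter matrices in terms of the noise. -/

section WeightedMean

variable {n : ℕ} {x z : ℕ → EuclideanSpace ℝ (Fin p)} {w : ℕ → ℝ} {μ : EuclideanSpace ℝ (Fin p)}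

/-- The alternative in `h` lets one lemma serve both classes: an observation of the other class has
weight zero. -/
lemma weightedMean_eq (h : ∀ i, w i = 0 ∨ x i = μ + z i) (hw : ∑ i ∈ Finset.range n, w i ≠ 0) :
    weightedMean n x w =
      μ + (∑ i ∈ Finset.range n, w i)⁻¹ • ∑ i ∈ Finset.range n, w i • z i := by
  have e : ∑ i ∈ Finset.range n, w i • x i =
      (∑ i ∈ Finset.range n, w i) • μ + ∑ i ∈ Finset.range n, w i • z i := by
    rw [Finset.sum_smul, ← Finset.sum_add_distrib]
    refine Finset.sum_congr rfl fun i _ ↦ ?_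
    rcases h i with h | h <;> simp [h]
  rw [weightedMean, e, smul_add, smul_smul, inv_mul_cancel₀ hw, one_smul]

/-- The class mean `μ` cancels, and what remains is the identity "second moment minus squared mean".
-/
lemma sum_smul_outer_sub_weightedMean (h : ∀ i, w i = 0 ∨ x i = μ + z i)
    (hw : ∑ i ∈ Finset.range n, w i ≠ 0) :
    ∑ i ∈ Finset.range n, w i • outer (x i - weightedMean n x w) =
      ∑ i ∈ Finset.range n, w i • outer (z i) -
        (∑ i ∈ Finset.range n, w i)⁻¹ • outer (∑ i ∈ Finset.range n, w i • z i) := by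
  rw [weightedMean_eq h hw]
  set W := ∑ i ∈ Finset.range n, w i with hW
  set A := ∑ i ∈ Finset.range n, w i • z i with hA
  have e (i : ℕ) : w i • outer (x i - (μ + W⁻¹ • A)) = w i • outer (z i - W⁻¹ • A) := by
    rcases h i with h | h <;> simp [h]
  simp_rw [e]
  have hAj (j : Fin p) : A j = ∑ i ∈ Finset.range n, w i * z i j := by
    simp [hA]
  ext j k
  have e' (i : ℕ) : w i * ((z i j - W⁻¹ * A j) * (z i k - W⁻¹ * A k)) =
      w i * (z i j * z i k) - (w i * z i j) * (W⁻¹ * A k) - (w i * z i k) * (W⁻¹ * A j) +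
        w i * (W⁻¹ * A j * (W⁻¹ * A k)) := by ring
  simp only [Matrix.sum_apply, Matrix.smul_apply, outer_apply, Matrix.sub_apply, PiLp.sub_apply, PiLp.smul_apply,
    smul_eq_mul, e', Finset.sum_add_distrib, Finset.sum_sub_distrib, ← Finset.sum_mul, ← hAj, ← hW]
  field_simp
  ring

end WeightedMean

/-! ### Exact formulas for the estimators and for normalisation. -/

section Decomposition

variable {n : ℕ} {x z : ℕ → EuclideanSpace ℝ (Fin p)} {y : ℕ → ℝ}
  {μ₁ μ₂ θ : EuclideanSpace ℝ (Fin p)} {S : Matrix (Fin p) (Fin p) ℝ}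

lemma label_eq_zero_or (hy : ∀ i, y i = 1 ∨ y i = 0)
    (hx : ∀ i, x i = y i • μ₁ + (1 - y i) • μ₂ + z i) (i : ℕ) : y i = 0 ∨ x i = μ₁ + z i := by
  rcases hy i with h | h <;> simp [hx, h]

lemma one_sub_label_eq_zero_or (hy : ∀ i, y i = 1 ∨ y i = 0)
    (hx : ∀ i, x i = y i • μ₁ + (1 - y i) • μ₂ + z i) (i : ℕ) :
    1 - y i = 0 ∨ x i = μ₂ + z i := by
  rcases hy i with h | h <;> simp [hx, h]

/-- The weights `y i` and `1 - y i` add up to one, so the two uncentred scatter sums merge into one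
sum free of labels. -/
lemma pooledCov_eq (hy : ∀ i, y i = 1 ∨ y i = 0)
    (hx : ∀ i, x i = y i • μ₁ + (1 - y i) • μ₂ + z i)
    (h₁ : ∑ i ∈ Finset.range n, y i ≠ 0) (h₂ : ∑ i ∈ Finset.range n, (1 - y i) ≠ 0) :
    pooledCov n x y = ((n : ℝ) - 2)⁻¹ • (∑ i ∈ Finset.range n, outer (z i) -
      (∑ i ∈ Finset.range n, y i)⁻¹ • outer (∑ i ∈ Finset.range n, y i • z i) -
      (∑ i ∈ Finset.range n, (1 - y i))⁻¹ •
        outer (∑ i ∈ Finset.range n, (1 - y i) • z i)) := by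
  rw [pooledCov, mean₁, mean₂, sum_smul_outer_sub_weightedMean (label_eq_zero_or hy hx) h₁,
    sum_smul_outer_sub_weightedMean (one_sub_label_eq_zero_or hy hx) h₂]
  have : ∑ i ∈ Finset.range n, outer (z i) = ∑ i ∈ Finset.range n, y i • outer (z i) +
      ∑ i ∈ Finset.range n, (1 - y i) • outer (z i) := by
    rw [← Finset.sum_add_distrib]
    refine Finset.sum_congr rfl fun i _ ↦ ?_
    rw [← add_smul]
    simp
  rw [this]
  congr 1
  abel

lemma mean₂_sub_mean₁ (hy : ∀ i, y i = 1 ∨ y i = 0)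
    (hx : ∀ i, x i = y i • μ₁ + (1 - y i) • μ₂ + z i)
    (h₁ : ∑ i ∈ Finset.range n, y i ≠ 0) (h₂ : ∑ i ∈ Finset.range n, (1 - y i) ≠ 0) :
    mean₂ n x y - mean₁ n x y = μ₂ - μ₁ +
      ((∑ i ∈ Finset.range n, (1 - y i))⁻¹ • ∑ i ∈ Finset.range n, (1 - y i) • z i -
        (∑ i ∈ Finset.range n, y i)⁻¹ • ∑ i ∈ Finset.range n, y i • z i) := by
  rw [mean₁, mean₂, weightedMean_eq (label_eq_zero_or hy hx) h₁,
    weightedMean_eq (one_sub_label_eq_zero_or hy hx) h₂]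
  abel

/-- The matrix `L` with `unit w - unit θ = L (w - θ)`. -/
noncomputable def unitSlope (θ w : EuclideanSpace ℝ (Fin p)) : Matrix (Fin p) (Fin p) ℝ :=
  ‖w‖⁻¹ • 1 - (‖w‖ * ‖θ‖ * (‖w‖ + ‖θ‖))⁻¹ • vecMulVec θ.ofLp (w + θ).ofLp

/-- Uses `‖w‖² - ‖θ‖² = ⟪w + θ, w - θ⟫`. As the identity is exact, continuity of the slope at `θ`
replaces the differentiation of a delta method. -/
lemma unit_sub_unit {w : EuclideanSpace ℝ (Fin p)} (hθ : θ ≠ 0) (hw : w ≠ 0) :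
    unit w - unit θ = mulVecE (unitSlope θ w) (w - θ) := by
  have hθ' : 0 < ‖θ‖ := norm_pos_iff.2 hθ
  have hw' : 0 < ‖w‖ := norm_pos_iff.2 hw
  have hi : ⟪w + θ, w - θ⟫ = (‖w‖ - ‖θ‖) * (‖w‖ + ‖θ‖) := by
    rw [inner_add_left, inner_sub_right, inner_sub_right, real_inner_self_eq_norm_sq,
      real_inner_self_eq_norm_sq, real_inner_comm]
    ring
  rw [unitSlope, sub_mulVecE, smul_mulVecE, smul_mulVecE, one_mulVecE, vecMulVec_mulVecE, hi,
    smul_smul, unit, unit, smul_sub, sub_sub, ← add_smul]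
  congr 2
  field_simp
  ring

lemma unitSlope_self : unitSlope θ θ = ‖θ‖⁻¹ • projCompl θ := by
  rcases eq_or_ne θ 0 with rfl | hθ
  · simp [unitSlope]
  have hθ' : 0 < ‖θ‖ := norm_pos_iff.2 hθ
  ext i j
  simp only [unitSlope, projCompl, outer, Matrix.sub_apply, Matrix.smul_apply, vecMulVec_apply, WithLp.ofLp_add,
    Pi.add_apply, smul_eq_mul]
  field_simp

end Decomposition

/-! ### The score vector and the expansion driven by its normalised sum. -/

section Score

/-- The `k`-th block of a vector made of three blocks. -/
noncomputable def block (k : Fin 3) :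
    EuclideanSpace ℝ (Fin 3 × Fin p) →L[ℝ] EuclideanSpace ℝ (Fin p) :=
  LinearMap.toContinuousLinearMap
    { toFun := fun v ↦ WithLp.toLp 2 fun j ↦ v (k, j)
      map_add' := fun _ _ ↦ rfl
      map_smul' := fun _ _ ↦ rfl }

/-- The summands whose normalised sums drive the fluctuations of the LDA estimator. -/
noncomputable def score (S : Matrix (Fin p) (Fin p) ℝ) (θ : EuclideanSpace ℝ (Fin p))
    (u : ℝ × EuclideanSpace ℝ (Fin p)) : EuclideanSpace ℝ (Fin 3 × Fin p) :=
  WithLp.toLp 2 fun j ↦ (![u.1 • u.2, (1 - u.1) • u.2, ⟪θ, u.2⟫ • u.2 - mulVecE S θ] j.1) j.2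

variable (S : Matrix (Fin p) (Fin p) ℝ) (θ : EuclideanSpace ℝ (Fin p))
  (u : ℝ × EuclideanSpace ℝ (Fin p))

lemma block_zero_score : block 0 (score S θ u) = u.1 • u.2 := rfl

lemma block_one_score : block 1 (score S θ u) = (1 - u.1) • u.2 := rfl

lemma block_two_score : block 2 (score S θ u) = ⟪θ, u.2⟫ • u.2 - mulVecE S θ := rfl

/-- The first-order expansion of the normalised direction in terms of the normalised score sum `v`,
random scalars and a random matrix, all of which converge to constants. -/
noncomputable def expansion (v : EuclideanSpace ℝ (Fin 3 × Fin p))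
    (r : (ℝ × ℝ × ℝ × ℝ) × (Fin p → Fin p → ℝ)) : EuclideanSpace ℝ (Fin p) :=
  mulVecE (Matrix.of r.2) (r.1.2.1 • block 1 v - r.1.1 • block 0 v - r.1.2.2.1 • block 2 v
    - (2 * r.1.2.2.2) • mulVecE S θ
    + (r.1.2.2.2 * r.1.1 * ⟪θ, block 0 v⟫) • block 0 v
    + (r.1.2.2.2 * r.1.2.1 * ⟪θ, block 1 v⟫) • block 1 v)

lemma continuous_mulVecE :
    Continuous fun q : (Fin p → Fin p → ℝ) × EuclideanSpace ℝ (Fin p) ↦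
      mulVecE (Matrix.of q.1) q.2 := by
  refine (PiLp.continuous_toLp 2 _).comp (continuous_pi fun i ↦ ?_)
  simp only [mulVec, dotProduct, Matrix.of_apply]
  fun_prop

lemma continuous_expansion : Continuous fun q : EuclideanSpace ℝ (Fin 3 × Fin p) ×
    ((ℝ × ℝ × ℝ × ℝ) × (Fin p → Fin p → ℝ)) ↦ expansion S θ q.1 q.2 := by
  unfold expansion
  refine continuous_mulVecE.comp (Continuous.prodMk (by fun_prop) ?_)
  fun_prop

end Score

/-! ### The exact expansion of the normalised direction. -/

section Fluctuation

variable {n : ℕ} {x z : ℕ → EuclideanSpace ℝ (Fin p)} {y : ℕ → ℝ}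
  {μ₁ μ₂ θ : EuclideanSpace ℝ (Fin p)} {S : Matrix (Fin p) (Fin p) ℝ}

/-- The random coefficients of `expansion`. -/
noncomputable def coeffs (n : ℕ) (x : ℕ → EuclideanSpace ℝ (Fin p)) (y : ℕ → ℝ)
    (θ : EuclideanSpace ℝ (Fin p)) : (ℝ × ℝ × ℝ × ℝ) × (Fin p → Fin p → ℝ) :=
  ((n * (∑ i ∈ Finset.range n, y i)⁻¹, n * (∑ i ∈ Finset.range n, (1 - y i))⁻¹,
    n * ((n : ℝ) - 2)⁻¹, √(n : ℝ) * ((n : ℝ) - 2)⁻¹),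
    unitSlope θ (ldaEstimator n x y) * (pooledCov n x y)⁻¹)

/-- With `μ₂ - μ₁ = S θ`, the error of `S_n θ` splits into the third score block, the bias `S θ -
n/(n - 2) S θ = -2/(n - 2) S θ`, and two rank-one corrections from estimating the class means,
quadratic in the first two blocks. -/
lemma sqrt_smul_unit_sub_unit (hy : ∀ i, y i = 1 ∨ y i = 0)
    (hx : ∀ i, x i = y i • μ₁ + (1 - y i) • μ₂ + z i) (hn : 3 ≤ n)
    (h₁ : ∑ i ∈ Finset.range n, y i ≠ 0) (h₂ : ∑ i ∈ Finset.range n, (1 - y i) ≠ 0)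
    (hS : IsUnit (pooledCov n x y).det) (hw : ldaEstimator n x y ≠ 0) (hθ : θ ≠ 0)
    (hSθ : mulVecE S θ = μ₂ - μ₁) :
    √(n : ℝ) • (unit (ldaEstimator n x y) - unit θ) =
      expansion S θ ((√(n : ℝ))⁻¹ • ∑ i ∈ Finset.range n, score S θ (y i, z i))
        (coeffs n x y θ) := by
  have e : ldaEstimator n x y - θ = mulVecE (pooledCov n x y)⁻¹
      (mean₂ n x y - mean₁ n x y - mulVecE (pooledCov n x y) θ) := by
    rw [mulVecE_sub, mulVecE_mulVecE, nonsing_inv_mul _ hS, one_mulVecE]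
    rfl
  rw [unit_sub_unit hθ hw, e, mulVecE_mulVecE, ← mulVecE_smul, expansion, coeffs]
  congr 1
  have hn0 : (0 : ℝ) < n := by positivity
  have hn2 : (n : ℝ) - 2 ≠ 0 := by
    have : (3 : ℝ) ≤ n := by exact_mod_cast hn
    linarith
  have hs : √(n : ℝ) ≠ 0 := (Real.sqrt_pos.2 hn0).ne'
  have hq : √(n : ℝ) * √(n : ℝ) = n := Real.mul_self_sqrt hn0.le
  simp only [map_smul, map_sum, block_zero_score, block_one_score, block_two_score]
  rw [mean₂_sub_mean₁ hy hx h₁ h₂, pooledCov_eq hy hx h₁ h₂, ← hSθ]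
  simp only [smul_mulVecE, sub_mulVecE, sum_mulVecE, outer_mulVecE, Finset.sum_sub_distrib,
    Finset.sum_const, Finset.card_range, inner_smul_right, real_inner_comm θ]
  set A := ∑ i ∈ Finset.range n, y i • z i
  set B := ∑ i ∈ Finset.range n, (1 - y i) • z i
  set C := ∑ i ∈ Finset.range n, ⟪θ, z i⟫ • z i
  set a := ∑ i ∈ Finset.range n, y i
  set b := ∑ i ∈ Finset.range n, (1 - y i)
  set D := mulVecE S θ
  rw [← Nat.cast_smul_eq_nsmul ℝ]
  -- With `n = s²` the coefficient identities become rational in `s`.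
  generalize √(n : ℝ) = s at *
  rw [← hq, ← pow_two] at hn2
  match_scalars
  all_goals rw [← hq, ← pow_two]
  all_goals field_simp
  all_goals ring

end Fluctuation

/-! ### Pathwise limits of the estimators and coefficients. -/

section Limits

lemma tendsto_natCast_mul_inv_sub_two :
    Tendsto (fun n : ℕ ↦ (n : ℝ) * ((n : ℝ) - 2)⁻¹) atTop (𝓝 1) := by
  have h : Tendsto (fun n : ℕ ↦ (1 - 2 * (n : ℝ)⁻¹)⁻¹) atTop (𝓝 1) := by
    have := ((tendsto_inv_atTop_nhds_zero_nat (𝕜 := ℝ)).const_mul 2).const_sub 1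
    simpa using this.inv₀ (by norm_num)
  refine h.congr' ?_
  filter_upwards [eventually_gt_atTop 0] with n hn
  have : (n : ℝ) ≠ 0 := by positivity
  rw [show (n : ℝ) - 2 = n * (1 - 2 * (n : ℝ)⁻¹) by field_simp, mul_inv, ← mul_assoc,
    mul_inv_cancel₀ this, one_mul]

lemma tendsto_sqrt_natCast_mul_inv_sub_two :
    Tendsto (fun n : ℕ ↦ √(n : ℝ) * ((n : ℝ) - 2)⁻¹) atTop (𝓝 0) := by
  have h : Tendsto (fun n : ℕ ↦ (√(n : ℝ))⁻¹) atTop (𝓝 0) :=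
    tendsto_inv_atTop_zero.comp (Real.tendsto_sqrt_atTop.comp tendsto_natCast_atTop_atTop)
  have := h.mul tendsto_natCast_mul_inv_sub_two
  rw [zero_mul] at this
  refine this.congr' ?_
  filter_upwards [eventually_gt_atTop 0] with n hn
  have hn0 : (0 : ℝ) < n := by positivity
  have hs : √(n : ℝ) ≠ 0 := (Real.sqrt_pos.2 hn0).ne'
  nth_rw 2 [← Real.mul_self_sqrt hn0.le]
  field_simp

lemma continuous_outer : Continuous (outer : EuclideanSpace ℝ (Fin p) → _) := by
  refine continuous_matrix fun i j ↦ ?_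
  simp only [outer_apply]
  fun_prop

lemma continuousAt_inv {A : Matrix (Fin p) (Fin p) ℝ} (hA : A.det ≠ 0) :
    ContinuousAt (fun B : Matrix (Fin p) (Fin p) ℝ ↦ B⁻¹) A := by
  simp only [inv_def, Ring.inverse_eq_inv']
  exact (continuous_id.matrix_det.continuousAt.inv₀ hA).smul
    continuous_id.matrix_adjugate.continuousAt

lemma continuousAt_unitSlope {θ : EuclideanSpace ℝ (Fin p)} (hθ : θ ≠ 0) :
    ContinuousAt (unitSlope θ) θ := by
  have h : 0 < ‖θ‖ := norm_pos_iff.2 hθ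
  unfold unitSlope
  refine (((continuous_norm.continuousAt).inv₀ h.ne').smul continuousAt_const).sub
    (ContinuousAt.smul (f := fun w ↦ (‖w‖ * ‖θ‖ * (‖w‖ + ‖θ‖))⁻¹)
      (ContinuousAt.inv₀ (by fun_prop) (by positivity)) ?_)
  exact (Continuous.matrix_vecMulVec (by fun_prop) (by fun_prop)).continuousAt

lemma tendsto_mulVecE {ι : Type*} {l : Filter ι} {A : ι → Matrix (Fin p) (Fin p) ℝ}
    {v : ι → EuclideanSpace ℝ (Fin p)} {A₀ : Matrix (Fin p) (Fin p) ℝ}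
    {v₀ : EuclideanSpace ℝ (Fin p)} (hA : Tendsto A l (𝓝 A₀)) (hv : Tendsto v l (𝓝 v₀)) :
    Tendsto (fun i ↦ mulVecE (A i) (v i)) l (𝓝 (mulVecE A₀ v₀)) :=
  (continuous_mulVecE.tendsto (A₀, v₀)).comp (hA.prodMk_nhds hv)

variable {x z : ℕ → EuclideanSpace ℝ (Fin p)} {y : ℕ → ℝ} {a : ℝ}
  {μ₁ μ₂ : EuclideanSpace ℝ (Fin p)} {S : Matrix (Fin p) (Fin p) ℝ}

/-- The conditions on a realisation of the sample under which the estimators converge; they hold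
almost surely by the strong law of large numbers. -/
structure IsRegular (a : ℝ) (μ₁ μ₂ : EuclideanSpace ℝ (Fin p)) (S : Matrix (Fin p) (Fin p) ℝ)
    (x z : ℕ → EuclideanSpace ℝ (Fin p)) (y : ℕ → ℝ) : Prop where
  label : ∀ i, y i = 1 ∨ y i = 0
  eq_add : ∀ i, x i = y i • μ₁ + (1 - y i) • μ₂ + z i
  tendsto_label : Tendsto (fun n : ℕ ↦ (n : ℝ)⁻¹ * ∑ i ∈ Finset.range n, y i) atTop (𝓝 a)
  tendsto_fst : Tendsto (fun n : ℕ ↦ (n : ℝ)⁻¹ • ∑ i ∈ Finset.range n, y i • z i) atTop (𝓝 0)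
  tendsto_snd :
    Tendsto (fun n : ℕ ↦ (n : ℝ)⁻¹ • ∑ i ∈ Finset.range n, (1 - y i) • z i) atTop (𝓝 0)
  tendsto_outer :
    Tendsto (fun n : ℕ ↦ (n : ℝ)⁻¹ • ∑ i ∈ Finset.range n, outer (z i)) atTop (𝓝 S)

namespace IsRegular

lemma tendsto_one_sub_label (h : IsRegular a μ₁ μ₂ S x z y) :
    Tendsto (fun n : ℕ ↦ (n : ℝ)⁻¹ * ∑ i ∈ Finset.range n, (1 - y i)) atTop (𝓝 (1 - a)) := by
  refine (h.tendsto_label.const_sub 1).congr' ?_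
  filter_upwards [eventually_gt_atTop 0] with n hn
  have : (n : ℝ) ≠ 0 := by positivity
  simp [mul_sub, this]

lemma eventually_sum_label_ne_zero (h : IsRegular a μ₁ μ₂ S x z y)
    (ha : 0 < a) :
    ∀ᶠ n : ℕ in atTop, ∑ i ∈ Finset.range n, y i ≠ 0 := by
  filter_upwards [h.tendsto_label.eventually_ne ha.ne'] with n hn h0
  simp [h0] at hn

lemma eventually_sum_one_sub_label_ne_zero (h : IsRegular a μ₁ μ₂ S x z y)
    (ha : a < 1) :
    ∀ᶠ n : ℕ in atTop, ∑ i ∈ Finset.range n, (1 - y i) ≠ 0 := by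
  filter_upwards [h.tendsto_one_sub_label.eventually_ne (sub_pos.2 ha).ne'] with n hn h0
  rw [h0] at hn
  simp at hn

lemma tendsto_mul_inv_label (h : IsRegular a μ₁ μ₂ S x z y)
    (ha : 0 < a) :
    Tendsto (fun n : ℕ ↦ (n : ℝ) * (∑ i ∈ Finset.range n, y i)⁻¹) atTop (𝓝 a⁻¹) := by
  refine (h.tendsto_label.inv₀ ha.ne').congr fun n ↦ ?_
  rw [mul_inv, inv_inv]

lemma tendsto_mul_inv_one_sub_label (h : IsRegular a μ₁ μ₂ S x z y)
    (ha : a < 1) :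
    Tendsto (fun n : ℕ ↦ (n : ℝ) * (∑ i ∈ Finset.range n, (1 - y i))⁻¹) atTop (𝓝 (1 - a)⁻¹) := by
  refine (h.tendsto_one_sub_label.inv₀ (sub_pos.2 ha).ne').congr fun n ↦ ?_
  rw [mul_inv, inv_inv]

/-- After division by `n`, each mean correction is a bounded factor times `outer` of an average
tending to zero. -/
lemma tendsto_pooledCov (h : IsRegular a μ₁ μ₂ S x z y)
    (ha₀ : 0 < a) (ha₁ : a < 1) :
    Tendsto (fun n ↦ pooledCov n x y) atTop (𝓝 S) := by
  have hA := (h.tendsto_mul_inv_label ha₀).smul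
    ((continuous_outer.tendsto _).comp h.tendsto_fst)
  have hB := (h.tendsto_mul_inv_one_sub_label ha₁).smul
    ((continuous_outer.tendsto _).comp h.tendsto_snd)
  have h0 : outer (0 : EuclideanSpace ℝ (Fin p)) = 0 := by
    ext i j
    simp [outer_apply]
  have := tendsto_natCast_mul_inv_sub_two.smul ((h.tendsto_outer.sub hA).sub hB)
  simp only [h0, smul_zero, sub_zero, one_smul] at this
  refine this.congr' ?_
  filter_upwards [eventually_gt_atTop 0, h.eventually_sum_label_ne_zero ha₀,
    h.eventually_sum_one_sub_label_ne_zero ha₁] with n hn h₁ h₂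
  have hn0 : (n : ℝ) ≠ 0 := by positivity
  rw [pooledCov_eq h.label h.eq_add h₁ h₂]
  simp only [Function.comp_apply, outer_smul, smul_sub, smul_smul]
  congr 2
  · congr 1
    field_simp
  · congr 1
    field_simp
  · field_simp

lemma tendsto_mean_sub_mean (h : IsRegular a μ₁ μ₂ S x z y)
    (ha₀ : 0 < a) (ha₁ : a < 1) :
    Tendsto (fun n ↦ mean₂ n x y - mean₁ n x y) atTop (𝓝 (μ₂ - μ₁)) := by
  have hA := (h.tendsto_mul_inv_label ha₀).smul h.tendsto_fst
  have hB := (h.tendsto_mul_inv_one_sub_label ha₁).smul h.tendsto_snd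
  have := (hB.sub hA).const_add (μ₂ - μ₁)
  simp only [smul_zero, sub_zero, add_zero] at this
  refine this.congr' ?_
  filter_upwards [eventually_gt_atTop 0, h.eventually_sum_label_ne_zero ha₀,
    h.eventually_sum_one_sub_label_ne_zero ha₁] with n hn h₁ h₂
  have hn0 : (n : ℝ) ≠ 0 := by positivity
  rw [mean₂_sub_mean₁ h.label h.eq_add h₁ h₂]
  simp only [smul_smul]
  congr 3 <;> field_simp

lemma tendsto_ldaEstimator (h : IsRegular a μ₁ μ₂ S x z y)
    (ha₀ : 0 < a) (ha₁ : a < 1) (hS : S.det ≠ 0) :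
    Tendsto (fun n ↦ ldaEstimator n x y) atTop (𝓝 (discriminant μ₁ μ₂ S)) :=
  tendsto_mulVecE ((continuousAt_inv hS).tendsto.comp (h.tendsto_pooledCov ha₀ ha₁))
    (h.tendsto_mean_sub_mean ha₀ ha₁)

lemma tendsto_coeffs (h : IsRegular a μ₁ μ₂ S x z y)
    (ha₀ : 0 < a) (ha₁ : a < 1) (hS : S.det ≠ 0)
    (hθ : discriminant μ₁ μ₂ S ≠ 0) :
    Tendsto (fun n ↦ coeffs n x y (discriminant μ₁ μ₂ S)) atTop
      (𝓝 ((a⁻¹, (1 - a)⁻¹, 1, 0),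
        unitSlope (discriminant μ₁ μ₂ S) (discriminant μ₁ μ₂ S) * S⁻¹)) := by
  refine Tendsto.prodMk_nhds ?_ ?_
  · exact (h.tendsto_mul_inv_label ha₀).prodMk_nhds
      ((h.tendsto_mul_inv_one_sub_label ha₁).prodMk_nhds
        (tendsto_natCast_mul_inv_sub_two.prodMk_nhds tendsto_sqrt_natCast_mul_inv_sub_two))
  · have h1 := (continuousAt_unitSlope hθ).tendsto.comp (h.tendsto_ldaEstimator ha₀ ha₁ hS)
    have h2 := (continuousAt_inv hS).tendsto.comp (h.tendsto_pooledCov ha₀ ha₁)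
    exact h1.mul h2

/-- On a regular realisation an empty class, a singular `S_n` or a zero estimator occurs for only
finitely many `n`, so the default values of inverses do not affect the limit. -/
lemma eventually_sqrt_smul_unit_sub_unit (h : IsRegular a μ₁ μ₂ S x z y)
    (ha₀ : 0 < a) (ha₁ : a < 1) (hS : S.det ≠ 0)
    (hθ : discriminant μ₁ μ₂ S ≠ 0) :
    ∀ᶠ n : ℕ in atTop,
      √(n : ℝ) • (unit (ldaEstimator n x y) - unit (discriminant μ₁ μ₂ S)) =
        expansion S (discriminant μ₁ μ₂ S) ((√(n : ℝ))⁻¹ •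
          ∑ i ∈ Finset.range n, score S (discriminant μ₁ μ₂ S) (y i, z i))
          (coeffs n x y (discriminant μ₁ μ₂ S)) := by
  have hd : ∀ᶠ n in atTop, (pooledCov n x y).det ≠ 0 :=
    ((continuous_id.matrix_det.tendsto S).comp (h.tendsto_pooledCov ha₀ ha₁)).eventually_ne hS
  filter_upwards [eventually_ge_atTop 3, h.eventually_sum_label_ne_zero ha₀,
    h.eventually_sum_one_sub_label_ne_zero ha₁, hd,
    (h.tendsto_ldaEstimator ha₀ ha₁ hS).eventually_ne hθ] with n hn h₁ h₂ hd hw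
  refine sqrt_smul_unit_sub_unit h.label h.eq_add hn h₁ h₂ hd.isUnit hw hθ ?_
  rw [discriminant, mulVecE_mulVecE, mul_nonsing_inv _ hS.isUnit, one_mulVecE]

end IsRegular

end Limits

/-! ### Measurability of the estimators. -/

section Measurability

lemma measurable_mulVecE {β : Type*} [MeasurableSpace β] {A : β → Matrix (Fin p) (Fin p) ℝ}
    {v : β → EuclideanSpace ℝ (Fin p)} (hA : ∀ i j, Measurable fun b ↦ A b i j)
    (hv : Measurable v) : Measurable fun b ↦ mulVecE (A b) (v b) := by
  refine (PiLp.continuous_toLp 2 _).measurable.comp (measurable_pi_lambda _ fun i ↦ ?_)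
  simp only [mulVec, dotProduct]
  fun_prop

lemma measurable_weightedMean {β : Type*} [MeasurableSpace β] (n : ℕ)
    {x : β → ℕ → EuclideanSpace ℝ (Fin p)} {w : β → ℕ → ℝ} (hx : Measurable x)
    (hw : Measurable w) : Measurable fun b ↦ weightedMean n (x b) (w b) := by
  unfold weightedMean
  fun_prop

lemma measurable_matrix_inv {β : Type*} [MeasurableSpace β] {A : β → Matrix (Fin p) (Fin p) ℝ}
    (hA : ∀ i j, Measurable fun b ↦ A b i j) (i j : Fin p) :
    Measurable fun b ↦ (A b)⁻¹ i j := by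
  have hA' : Measurable fun b i j ↦ A b i j :=
    measurable_pi_lambda _ fun i ↦ measurable_pi_lambda _ (hA i)
  have hof : Continuous fun B : Fin p → Fin p → ℝ ↦ Matrix.of B := continuous_id
  have h1 : Measurable fun B : Fin p → Fin p → ℝ ↦ (Matrix.of B).det :=
    hof.matrix_det.measurable
  have h2 : Measurable fun B : Fin p → Fin p → ℝ ↦ (Matrix.of B).adjugate i j :=
    (hof.matrix_adjugate.matrix_elem i j).measurable
  simp only [inv_def, Ring.inverse_eq_inv', Matrix.smul_apply, smul_eq_mul]
  exact (h1.comp hA').inv.mul (h2.comp hA')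

variable (n : ℕ)

/-- Realisations of the sample: the sequence of observations and the sequence of labels. -/
abbrev Realisation (p : ℕ) : Type := (ℕ → EuclideanSpace ℝ (Fin p)) × (ℕ → ℝ)

lemma measurable_mean₁ : Measurable fun q : Realisation p ↦ mean₁ n q.1 q.2 :=
  measurable_weightedMean n measurable_fst measurable_snd

lemma measurable_mean₂ : Measurable fun q : Realisation p ↦ mean₂ n q.1 q.2 :=
  measurable_weightedMean n measurable_fst (by fun_prop)

lemma measurable_pooledCov (i j : Fin p) :
    Measurable fun q : Realisation p ↦ pooledCov n q.1 q.2 i j := by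
  have h₁ := measurable_mean₁ (p := p) n
  have h₂ := measurable_mean₂ (p := p) n
  simp only [pooledCov, Matrix.smul_apply, Matrix.add_apply, Matrix.sum_apply, outer_apply]
  fun_prop

lemma measurable_ldaEstimator :
    Measurable fun q : Realisation p ↦ ldaEstimator n q.1 q.2 :=
  measurable_mulVecE (measurable_matrix_inv (measurable_pooledCov n))
    ((measurable_mean₂ n).sub (measurable_mean₁ n))

lemma measurable_unitSlope {β : Type*} [MeasurableSpace β] {w : β → EuclideanSpace ℝ (Fin p)}
    (θ : EuclideanSpace ℝ (Fin p)) (hw : Measurable w) (i j : Fin p) :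
    Measurable fun b ↦ unitSlope θ (w b) i j := by
  simp only [unitSlope, Matrix.sub_apply, Matrix.smul_apply, vecMulVec_apply, WithLp.ofLp_add,
    Pi.add_apply, smul_eq_mul]
  fun_prop

lemma measurable_coeffs (θ : EuclideanSpace ℝ (Fin p)) :
    Measurable fun q : Realisation p ↦ coeffs n q.1 q.2 θ := by
  refine Measurable.prodMk (by fun_prop) ?_
  have h1 := measurable_unitSlope θ (measurable_ldaEstimator (p := p) n)
  have h2 := measurable_matrix_inv (measurable_pooledCov (p := p) n)
  refine measurable_pi_lambda _ fun i ↦ measurable_pi_lambda _ fun j ↦ ?_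
  simp only [mul_apply]
  exact Finset.measurable_sum _ fun k _ ↦ (h1 i k).mul (h2 k j)

lemma measurable_unit : Measurable (unit : EuclideanSpace ℝ (Fin p) → _) := by
  unfold unit
  fun_prop

lemma measurable_score (S : Matrix (Fin p) (Fin p) ℝ) (θ : EuclideanSpace ℝ (Fin p)) :
    Measurable (score S θ) := by
  refine (PiLp.continuous_toLp 2 _).measurable.comp (measurable_pi_lambda _ fun ⟨k, j⟩ ↦ ?_)
  fin_cases k
  · change Measurable fun u : ℝ × EuclideanSpace ℝ (Fin p) ↦ (u.1 • u.2) j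
    fun_prop
  · change Measurable fun u : ℝ × EuclideanSpace ℝ (Fin p) ↦ ((1 - u.1) • u.2) j
    fun_prop
  · change Measurable fun u : ℝ × EuclideanSpace ℝ (Fin p) ↦ (⟪θ, u.2⟫ • u.2 - mulVecE S θ) j
    fun_prop

end Measurability

/-! ### Mean and variance of the score. -/

section ScoreMoments

variable {S : Matrix (Fin p) (Fin p) ℝ} {θ : EuclideanSpace ℝ (Fin p)} {q : unitInterval}

lemma inner_single_one (j : Fin p) (z : EuclideanSpace ℝ (Fin p)) :
    ⟪EuclideanSpace.single j (1 : ℝ), z⟫ = z j := by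
  simp [EuclideanSpace.inner_single_left]

lemma memLp_apply_multivariateGaussian (j : Fin p) :
    MemLp (fun z : EuclideanSpace ℝ (Fin p) ↦ z j) 2 (multivariateGaussian 0 S) := by
  simpa only [inner_single_one] using
    memLp_inner_multivariateGaussian (S := S) (EuclideanSpace.single j 1) 2 (by simp)

lemma integral_apply_multivariateGaussian (j : Fin p) :
    ∫ z : EuclideanSpace ℝ (Fin p), z j ∂(multivariateGaussian 0 S) = 0 := by
  simpa only [inner_single_one] using
    integral_inner_multivariateGaussian (S := S) (EuclideanSpace.single j 1)

lemma memLp_inner_mul_apply_multivariateGaussian (θ : EuclideanSpace ℝ (Fin p)) (j : Fin p) :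
    MemLp (fun z ↦ ⟪θ, z⟫ * z j) 2 (multivariateGaussian 0 S) := by
  simpa only [inner_single_one] using
    memLp_inner_mul_inner_multivariateGaussian (S := S) θ (EuclideanSpace.single j 1)

lemma integral_inner_mul_apply_multivariateGaussian (hS : S.PosSemidef)
    (θ : EuclideanSpace ℝ (Fin p)) (j : Fin p) :
    ∫ z, ⟪θ, z⟫ * z j ∂(multivariateGaussian 0 S) = mulVecE S θ j := by
  have := integral_inner_mul_inner_multivariateGaussian hS (EuclideanSpace.single j 1) θ
  simp only [inner_single_one] at this
  simp_rw [mul_comm _ (_ : ℝ)] at this ⊢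
  simpa [mulVecE, mul_comm] using this

lemma memLp_apply_mul_apply_multivariateGaussian (j k : Fin p) :
    MemLp (fun z : EuclideanSpace ℝ (Fin p) ↦ z j * z k) 2 (multivariateGaussian 0 S) := by
  simpa only [inner_single_one] using
    memLp_inner_mul_apply_multivariateGaussian (S := S) (EuclideanSpace.single j 1) k

lemma integral_apply_mul_apply_multivariateGaussian (hS : S.PosSemidef) (j k : Fin p) :
    ∫ z : EuclideanSpace ℝ (Fin p), z j * z k ∂(multivariateGaussian 0 S) = S j k := by
  have := integral_inner_mul_inner_multivariateGaussian hS (EuclideanSpace.single j 1)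
    (EuclideanSpace.single k 1)
  simpa [inner_single_one] using this

lemma memLp_score : MemLp (score S θ) 2
    ((bernoulliMeasure (1 : ℝ) 0 q).prod (multivariateGaussian 0 S)) := by
  refine MemLp.of_eval_piLp fun ⟨k, j⟩ ↦ memLp_two_bernoulliMeasure_prod
    (f := fun u ↦ score S θ u (k, j)) ?_ ?_ ?_
  · exact (EuclideanSpace.proj (𝕜 := ℝ) (k, j)).continuous.measurable.comp (measurable_score S θ)
  all_goals fin_cases k
  all_goals simp only [score, Fin.zero_eta, Fin.mk_one, Fin.reduceFinMk, Matrix.cons_val]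
  all_goals simp [memLp_apply_multivariateGaussian]
  all_goals exact (memLp_inner_mul_apply_multivariateGaussian θ j).sub (memLp_const _)

/-- The first two blocks are centred because `z` is, for either label; the third because `E ⟪θ, z⟫ z
= S θ`. -/
lemma integral_score (hS : S.PosSemidef) :
    ∫ u, score S θ u ∂((bernoulliMeasure (1 : ℝ) 0 q).prod (multivariateGaussian 0 S)) = 0 := by
  have hm (j) : Measurable fun u ↦ score S θ u j :=
    (EuclideanSpace.proj (𝕜 := ℝ) j).continuous.measurable.comp (measurable_score S θ)
  have hz (j : Fin p) : Integrable (fun z : EuclideanSpace ℝ (Fin p) ↦ z j)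
      (multivariateGaussian 0 S) :=
    (memLp_apply_multivariateGaussian j).integrable (by norm_num)
  have hzz (j : Fin p) : Integrable (fun z : EuclideanSpace ℝ (Fin p) ↦ ⟪θ, z⟫ * z j)
      (multivariateGaussian 0 S) :=
    (memLp_inner_mul_apply_multivariateGaussian θ j).integrable (by norm_num)
  ext ⟨k, j⟩
  rw [eval_integral_piLp fun i ↦ (memLp_score.integrable (by norm_num)).eval_piLp i]
  rw [integral_bernoulliMeasure_prod (hm _)]
  all_goals fin_cases k
  all_goals simp only [score, Fin.zero_eta, Fin.mk_one, Fin.reduceFinMk, Matrix.cons_val]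
  all_goals simp [hz, integral_apply_multivariateGaussian]
  · rw [integral_sub (hzz j) (integrable_const _),
      integral_inner_mul_apply_multivariateGaussian hS]
    simp
  all_goals exact (hzz j).sub (integrable_const _)

/-- The linear map through which the normalised score sum enters the limit. -/
noncomputable def limitMap (a : ℝ) (M : Matrix (Fin p) (Fin p) ℝ) :
    EuclideanSpace ℝ (Fin 3 × Fin p) →L[ℝ] EuclideanSpace ℝ (Fin p) :=
  toEuclideanCLM (𝕜 := ℝ) M ∘L ((1 - a)⁻¹ • block 1 - a⁻¹ • block 0 - block 2)

lemma limitMap_apply (a : ℝ) (M : Matrix (Fin p) (Fin p) ℝ)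
    (v : EuclideanSpace ℝ (Fin 3 × Fin p)) : limitMap a M v =
      mulVecE M ((1 - a)⁻¹ • block 1 v - a⁻¹ • block 0 v - block 2 v) := rfl

lemma expansion_limit (a : ℝ) (M : Matrix (Fin p) (Fin p) ℝ)
    (v : EuclideanSpace ℝ (Fin 3 × Fin p)) :
    expansion S θ v ((a⁻¹, (1 - a)⁻¹, 1, 0), M) = limitMap a M v := by
  simp only [expansion, limitMap_apply, one_smul, mul_zero, zero_mul, zero_smul, sub_zero,
    add_zero]
  rfl

lemma inner_mulVecE (t w : EuclideanSpace ℝ (Fin p)) (M : Matrix (Fin p) (Fin p) ℝ) :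
    ⟪t, mulVecE M w⟫ = ⟪mulVecE Mᵀ t, w⟫ := by
  simp only [mulVecE, EuclideanSpace.inner_eq_star_dotProduct, star_trivial]
  rw [dotProduct_comm, dotProduct_mulVec, mulVec_transpose, dotProduct_comm]

/-- Given the label, the functional is `⟪s, z⟫` times a constant minus `⟪θ, z⟫`. The hypothesis `h`
makes the two Gaussian factors independent, so second moments multiply. -/
lemma variance_inner_limitMap_score (hq₀ : 0 < (q : ℝ)) (hq₁ : (q : ℝ) < 1) (hS : S.PosSemidef)
    {M : Matrix (Fin p) (Fin p) ℝ} (t : EuclideanSpace ℝ (Fin p))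
    (h : mulVecE M (mulVecE S θ) = 0) :
    Var[fun u ↦ ⟪t, limitMap q M (score S θ u)⟫;
      (bernoulliMeasure (1 : ℝ) 0 q).prod (multivariateGaussian 0 S)] =
      (t.ofLp ⬝ᵥ (M * S * Mᵀ) *ᵥ t.ofLp) *
        ((q * (1 - q) : ℝ)⁻¹ + θ.ofLp ⬝ᵥ S *ᵥ θ.ofLp) := by
  set s := mulVecE Mᵀ t with hs
  have hint := (memLp_score (S := S) (θ := θ) (q := q)).integrable (by norm_num)
  have hm := measurable_score S θ
  have h0 : s.ofLp ⬝ᵥ S *ᵥ θ.ofLp = 0 := by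
    have : ⟪t, mulVecE M (mulVecE S θ)⟫ = 0 := by rw [h, inner_zero_right]
    rw [inner_mulVecE, ← hs] at this
    simpa [EuclideanSpace.inner_eq_star_dotProduct, mulVecE, dotProduct_comm] using this
  have hsS : s.ofLp ⬝ᵥ S *ᵥ s.ofLp = t.ofLp ⬝ᵥ (M * S * Mᵀ) *ᵥ t.ofLp := by
    simp only [hs, mulVecE]
    rw [← mulVec_mulVec, ← mulVec_mulVec, mulVec_transpose, dotProduct_mulVec t.ofLp M]
  have hV (y : ℝ) (z : EuclideanSpace ℝ (Fin p)) : ⟪t, limitMap q M (score S θ (y, z))⟫ =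
      ⟪s, z⟫ * (((1 - q : ℝ)⁻¹ * (1 - y) - (q : ℝ)⁻¹ * y) - ⟪θ, z⟫) := by
    have h0' : ⟪s, mulVecE S θ⟫ = 0 := by
      simpa [EuclideanSpace.inner_eq_star_dotProduct, mulVecE, dotProduct_comm] using h0
    rw [limitMap_apply, inner_mulVecE, ← hs, block_zero_score, block_one_score, block_two_score]
    simp only [inner_sub_right, inner_smul_right, h0']
    ring
  have hL2 : MemLp (fun u ↦ ⟪t, limitMap q M (score S θ u)⟫) 2
      ((bernoulliMeasure (1 : ℝ) 0 q).prod (multivariateGaussian 0 S)) :=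
    ((limitMap q M).comp_memLp' memLp_score).const_inner t
  have hmean : ∫ u, ⟪t, limitMap q M (score S θ u)⟫
      ∂((bernoulliMeasure (1 : ℝ) 0 q).prod (multivariateGaussian 0 S)) = 0 := by
    rw [integral_inner ((limitMap q M).integrable_comp hint),
      ContinuousLinearMap.integral_comp_comm _ hint, integral_score hS]
    simp
  have hi (y : ℝ) : Integrable (fun z ↦ ⟪t, limitMap q M (score S θ (y, z))⟫ ^ 2)
      (multivariateGaussian 0 S) := by
    refine MemLp.integrable_sq ?_
    simp_rw [hV, mul_sub ⟪s, _⟫ _ ⟪θ, _⟫]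
    exact ((memLp_inner_multivariateGaussian s 2 (by simp)).mul_const _).sub
      (memLp_inner_mul_inner_multivariateGaussian s θ)
  rw [variance_of_integral_eq_zero hL2.aestronglyMeasurable.aemeasurable hmean,
    integral_bernoulliMeasure_prod (f := fun u ↦ ⟪t, limitMap q M (score S θ u)⟫ ^ 2)
      (by fun_prop) (hi 1) (hi 0)]
  simp_rw [hV]
  rw [integral_sq_inner_mul_sub_multivariateGaussian hS h0,
    integral_sq_inner_mul_sub_multivariateGaussian hS h0, hsS]
  -- Averaging over the label uses `q · q⁻² + (1 - q) · (1 - q)⁻² = (q (1 - q))⁻¹`.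
  have hq₂ : (1 - q : ℝ) ≠ 0 := by linarith
  field_simp
  ring

end ScoreMoments

/-! ### The limiting covariance matrix. -/

section LimitCov

variable {S : Matrix (Fin p) (Fin p) ℝ} {μ₁ μ₂ : EuclideanSpace ℝ (Fin p)}

lemma mulVecE_discriminant (hS : S.PosDef) :
    mulVecE S (discriminant μ₁ μ₂ S) = μ₂ - μ₁ := by
  rw [discriminant, mulVecE_mulVecE, mul_nonsing_inv _ hS.det_pos.ne'.isUnit, one_mulVecE]

lemma discriminant_ne_zero (hS : S.PosDef) (hμ : μ₁ ≠ μ₂) : discriminant μ₁ μ₂ S ≠ 0 := by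
  intro h
  have := mulVecE_discriminant (μ₁ := μ₁) (μ₂ := μ₂) hS
  rw [h] at this
  refine hμ (sub_eq_zero.1 ?_).symm
  rw [← this]
  simp [mulVecE]

lemma discriminant_dotProduct (hS : S.PosDef) :
    (discriminant μ₁ μ₂ S).ofLp ⬝ᵥ S *ᵥ (discriminant μ₁ μ₂ S).ofLp = mahalanobisSq μ₁ μ₂ S := by
  have := congrArg WithLp.ofLp (mulVecE_discriminant (μ₁ := μ₁) (μ₂ := μ₂) hS)
  simp only [mulVecE] at this
  rw [this, mahalanobisSq, dotProduct_comm]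
  rfl

lemma mahalanobisSq_nonneg (hS : S.PosDef) : 0 ≤ mahalanobisSq μ₁ μ₂ S := by
  rw [← discriminant_dotProduct hS]
  simpa using hS.posSemidef.dotProduct_mulVec_nonneg (discriminant μ₁ μ₂ S).ofLp

lemma transpose_projCompl (θ : EuclideanSpace ℝ (Fin p)) : (projCompl θ)ᵀ = projCompl θ := by
  simp [projCompl, outer, transpose_vecMulVec]

lemma projCompl_mulVecE_self (θ : EuclideanSpace ℝ (Fin p)) : mulVecE (projCompl θ) θ = 0 := by
  rcases eq_or_ne θ 0 with rfl | hθ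
  · simp [mulVecE]
  have : ‖θ‖ ^ 2 ≠ 0 := by simpa using hθ
  rw [projCompl, sub_mulVecE, one_mulVecE, smul_mulVecE, outer_mulVecE, smul_smul,
    real_inner_self_eq_norm_sq, inv_mul_cancel₀ this, one_smul, sub_self]

lemma posSemidef_limitCov (hS : S.PosDef) {a : ℝ} (ha₀ : 0 < a) (ha₁ : a < 1) :
    (limitCov a μ₁ μ₂ S).PosSemidef := by
  have h1 : 0 < 1 - a := sub_pos.2 ha₁
  have hτ := mahalanobisSq_nonneg (μ₁ := μ₁) (μ₂ := μ₂) hS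
  refine PosSemidef.smul ?_ (by positivity)
  have := hS.inv.posSemidef.mul_mul_conjTranspose_same (projCompl (discriminant μ₁ μ₂ S))
  rwa [conjTranspose_eq_transpose_of_trivial, transpose_projCompl] at this

lemma unitSlope_mul_inv_mul (hS : S.PosDef) (θ : EuclideanSpace ℝ (Fin p)) :
    unitSlope θ θ * S⁻¹ * S * (unitSlope θ θ * S⁻¹)ᵀ =
      (‖θ‖ ^ 2)⁻¹ • (projCompl θ * S⁻¹ * projCompl θ) := by
  have hSt : (S⁻¹)ᵀ = S⁻¹ := by
    simpa [conjTranspose_eq_transpose_of_trivial] using hS.inv.isHermitian.eq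
  rw [unitSlope_self, nonsing_inv_mul_cancel_right _ _ hS.det_pos.ne'.isUnit, transpose_mul, hSt,
    transpose_smul, transpose_projCompl]
  simp only [Matrix.smul_mul, Matrix.mul_smul, smul_smul, ← Matrix.mul_assoc]
  congr 1
  rw [pow_two, mul_inv]

end LimitCov

/-! ### Assembly: strong law, central limit theorem, Slutsky. -/

section Main

lemma center_fst (μ₁ μ₂ : EuclideanSpace ℝ (Fin p)) (u : EuclideanSpace ℝ (Fin p) × ℝ) :
    (center μ₁ μ₂ u).1 = u.2 := rfl

variable {Ω : Type*} [MeasurableSpace Ω] {P : Measure Ω}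
  {α₁ : unitInterval} {μ₁ μ₂ : EuclideanSpace ℝ (Fin p)} {S : Matrix (Fin p) (Fin p) ℝ}
  {X : ℕ → Ω → EuclideanSpace ℝ (Fin p)} {Y : ℕ → Ω → ℝ}

lemma IsSample.aemeasurable_realisation (h : IsSample P α₁ μ₁ μ₂ S X Y) :
    AEMeasurable (fun ω ↦ ((fun i ↦ X i ω, fun i ↦ Y i ω) : Realisation p)) P :=
  (aemeasurable_pi_lambda _ fun i ↦ (h.cond i).aemeasurable_snd).prodMk
    (aemeasurable_pi_lambda _ fun i ↦ (h.cond i).aemeasurable_fst)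

/-- The strong law is applied to each coordinate and each matrix entry; there are finitely many, so
the exceptional null sets combine. -/
lemma IsSample.ae_isRegular (h : IsSample P α₁ μ₁ μ₂ S X Y) (hS : S.PosSemidef) :
    ∀ᵐ ω ∂P, IsRegular α₁ μ₁ μ₂ S (fun i ↦ X i ω)
      (fun i ↦ (center μ₁ μ₂ (X i ω, Y i ω)).2) (fun i ↦ Y i ω) := by
  have hz (j : Fin p) : Integrable (fun z : EuclideanSpace ℝ (Fin p) ↦ z j)
      (multivariateGaussian 0 S) :=
    (memLp_apply_multivariateGaussian j).integrable (by norm_num)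
  have h1 := h.ae_tendsto_average (f := fun u ↦ u.1) (by fun_prop)
    (integrable_bernoulliMeasure_prod (by fun_prop) (by simp) (by simp))
  rw [integral_bernoulliMeasure_prod (by fun_prop) (by simp) (by simp)] at h1
  have h2 : ∀ᵐ ω ∂P, ∀ j, _ := ae_all_iff.2 fun j ↦
    h.ae_tendsto_average (f := fun u ↦ u.1 * u.2 j) (by fun_prop)
      (integrable_bernoulliMeasure_prod (by fun_prop) (by simpa using hz j) (by simp))
  have h3 : ∀ᵐ ω ∂P, ∀ j, _ := ae_all_iff.2 fun j ↦
    h.ae_tendsto_average (f := fun u ↦ (1 - u.1) * u.2 j) (by fun_prop)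
      (integrable_bernoulliMeasure_prod (by fun_prop) (by simp) (by simpa using hz j))
  have hzz (j k : Fin p) : Integrable (fun z : EuclideanSpace ℝ (Fin p) ↦ z j * z k)
      (multivariateGaussian 0 S) :=
    (memLp_apply_mul_apply_multivariateGaussian j k).integrable (by norm_num)
  have h4 : ∀ᵐ ω ∂P, ∀ j k, _ := ae_all_iff.2 fun j ↦ ae_all_iff.2 fun k ↦
    h.ae_tendsto_average (f := fun u ↦ u.2 j * u.2 k) (by fun_prop)
      (integrable_bernoulliMeasure_prod (by fun_prop) (hzz j k) (hzz j k))
  filter_upwards [h.ae_label, h1, h2, h3, h4] with ω hy h1 h2 h3 h4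
  refine ⟨hy, fun i ↦ ?_, ?_, ?_, ?_, ?_⟩
  · simp [center]
  · simpa [center] using h1
  · refine (PiLp.continuous_toLp 2 _).tendsto (0 : Fin p → ℝ) |>.comp
      (tendsto_pi_nhds.2 fun j ↦ ?_) |>.congr fun n ↦ rfl
    have := h2 j
    rw [integral_bernoulliMeasure_prod (by fun_prop) (by simpa using hz j) (by simp)] at this
    simpa [integral_apply_multivariateGaussian, center_fst] using this
  · refine (PiLp.continuous_toLp 2 _).tendsto (0 : Fin p → ℝ) |>.comp
      (tendsto_pi_nhds.2 fun j ↦ ?_) |>.congr fun n ↦ rfl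
    have := h3 j
    rw [integral_bernoulliMeasure_prod (by fun_prop) (by simp) (by simpa using hz j)] at this
    simpa [integral_apply_multivariateGaussian, center_fst] using this
  · refine tendsto_pi_nhds.2 fun j ↦ tendsto_pi_nhds.2 fun k ↦ ?_
    have := h4 j k
    rw [integral_bernoulliMeasure_prod (by fun_prop) (hzz j k) (hzz j k)] at this
    simp only [integral_apply_mul_apply_multivariateGaussian hS, ← add_mul, add_sub_cancel,
      one_mul] at this
    refine this.congr fun n ↦ ?_
    simp [Matrix.sum_apply, outer_apply]

lemma IsSample.tendstoInDistribution_score [IsProbabilityMeasure P]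
    (h : IsSample P α₁ μ₁ μ₂ S X Y) (hS : S.PosSemidef)
    (θ : EuclideanSpace ℝ (Fin p)) :
    TendstoInDistribution (fun (n : ℕ) ω ↦ (√(n : ℝ))⁻¹ •
        ∑ i ∈ Finset.range n, score S θ (center μ₁ μ₂ (X i ω, Y i ω))) atTop id (fun _ ↦ P)
      (multivariateGaussian 0
        (covMat P fun ω ↦ score S θ (center μ₁ μ₂ (X 0 ω, Y 0 ω)))) := by
  have hm := measurable_score S θ
  have hl := h.hasLaw_center 0
  refine tendstoInDistribution_inv_sqrt_smul_sum
    (ξ := fun i ω ↦ score S θ (center μ₁ μ₂ (X i ω, Y i ω))) ?_ ?_ (h.iIndepFun_comp_center hm)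
    (h.identDistrib_comp_center hm)
  · exact (memLp_map_measure_iff hm.aestronglyMeasurable hl.aemeasurable).1
      (hl.map_eq ▸ memLp_score)
  · rw [← integral_score (θ := θ) (q := α₁) hS, ← hl.map_eq,
      integral_map hl.aemeasurable hm.aestronglyMeasurable]

lemma IsSample.map_limitMap [IsProbabilityMeasure P]
    (h : IsSample P α₁ μ₁ μ₂ S X Y) (hS : S.PosDef) (hμ : μ₁ ≠ μ₂)
    (hα₀ : 0 < (α₁ : ℝ)) (hα₁ : (α₁ : ℝ) < 1) {θ : EuclideanSpace ℝ (Fin p)}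
    (hθ : θ = discriminant μ₁ μ₂ S) :
    (multivariateGaussian 0 (covMat P fun ω ↦ score S θ (center μ₁ μ₂ (X 0 ω, Y 0 ω)))).map
      (limitMap α₁ (unitSlope θ θ * S⁻¹)) =
      multivariateGaussian 0 (limitCov (α₁ : ℝ) μ₁ μ₂ S) := by
  have hm := measurable_score S θ
  have hl := h.hasLaw_center 0
  have hθ0 : θ ≠ 0 := hθ ▸ discriminant_ne_zero hS hμ
  refine map_multivariateGaussian_covMat ?_ _ (posSemidef_limitCov hS hα₀ hα₁) fun t ↦ ?_
  · exact (memLp_map_measure_iff hm.aestronglyMeasurable hl.aemeasurable).1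
      (hl.map_eq ▸ memLp_score)
  -- `S⁻¹ S` cancels, and the slope at `θ` is a multiple of the projection that kills `θ`:
  -- normalisation ignores changes of length.
  have hM : mulVecE (unitSlope θ θ * S⁻¹) (mulVecE S θ) = 0 := by
    rw [mulVecE_mulVecE, nonsing_inv_mul_cancel_right _ _ hS.det_pos.ne'.isUnit, unitSlope_self,
      smul_mulVecE, projCompl_mulVecE_self, smul_zero]
  have hv := variance_inner_limitMap_score (θ := θ) hα₀ hα₁ hS.posSemidef t hM
  rw [← hl.map_eq, variance_map (by fun_prop) hl.aemeasurable] at hv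
  refine hv.trans ?_
  rw [unitSlope_mul_inv_mul hS, limitCov, ← hθ, smul_mulVec, smul_mulVec, dotProduct_smul,
    dotProduct_smul, smul_eq_mul, smul_eq_mul, hθ, discriminant_dotProduct hS, ← hθ]
  have h0 : ‖θ‖ ≠ 0 := norm_ne_zero_iff.2 hθ0
  have h1 : (1 - α₁ : ℝ) ≠ 0 := (sub_pos.2 hα₁).ne'
  field_simp

/-- Asymptotic normality of the normalised LDA direction. -/
theorem IsSample.tendstoInDistribution_direction [IsProbabilityMeasure P]
    (h : IsSample P α₁ μ₁ μ₂ S X Y)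
    (hα₀ : 0 < (α₁ : ℝ)) (hα₁ : (α₁ : ℝ) < 1) (hμ : μ₁ ≠ μ₂) (hS : S.PosDef) :
    TendstoInDistribution
      (fun (n : ℕ) ω ↦ √(n : ℝ) • (unit (ldaEstimator n (fun i ↦ X i ω) (fun i ↦ Y i ω)) -
        unit (discriminant μ₁ μ₂ S)))
      atTop id (fun _ ↦ P) (multivariateGaussian 0 (limitCov (α₁ : ℝ) μ₁ μ₂ S)) := by
  set θ := discriminant μ₁ μ₂ S with hθ
  have hθ0 : θ ≠ 0 := discriminant_ne_zero hS hμ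
  have hdet : S.det ≠ 0 := hS.det_pos.ne'
  have hq := h.aemeasurable_realisation
  have hreg := h.ae_isRegular hS.posSemidef
  have hcm (n : ℕ) : AEMeasurable (fun ω ↦ coeffs n (fun i ↦ X i ω) (fun i ↦ Y i ω) θ) P :=
    (measurable_coeffs n θ).comp_aemeasurable hq
  have hum (n : ℕ) : AEMeasurable (fun ω ↦ √(n : ℝ) •
      (unit (ldaEstimator n (fun i ↦ X i ω) (fun i ↦ Y i ω)) - unit θ)) P := by
    have := (measurable_unit.comp (measurable_ldaEstimator n)).comp_aemeasurable hq
    exact (this.sub_const (unit θ)).const_smul (√(n : ℝ))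
  have hslutsky := (h.tendstoInDistribution_score hS.posSemidef
    θ).continuous_comp_prodMk_of_tendstoInMeasure_const (continuous_expansion S θ)
    (tendstoInMeasure_of_tendsto_ae (fun n ↦ (hcm n).aestronglyMeasurable)
      (hreg.mono fun ω hω ↦ hω.tendsto_coeffs hα₀ hα₁ hdet hθ0)) hcm
  -- Almost surely the expansion is exact for all large `n`, so the difference tends to zero almost
  -- surely and therefore in measure.
  have hdiff := tendstoInDistribution_of_tendstoInMeasure_sub
    (fun (n : ℕ) ω ↦ √(n : ℝ) •
      (unit (ldaEstimator n (fun i ↦ X i ω) (fun i ↦ Y i ω)) - unit θ)) _ hslutsky ?_ hum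
  · refine ⟨hum, aemeasurable_id, ?_⟩
    have := hdiff.tendsto
    convert this using 2
    refine congrArg 𝓝 (Subtype.ext ?_)
    -- Slutsky yields the law of the expansion at the limiting coefficients, which is the image of
    -- the Gaussian under `limitMap`.
    change Measure.map id _ = Measure.map _ _
    rw [Measure.map_id, ← h.map_limitMap hS hμ hα₀ hα₁ hθ]
    congr 1
    ext v : 1
    exact (expansion_limit _ _ _).symm
  · refine tendstoInMeasure_of_tendsto_ae (fun n ↦ ?_) ?_
    · exact ((hum n).sub (hslutsky.forall_aemeasurable n)).aestronglyMeasurable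
    · filter_upwards [hreg] with ω hω
      refine tendsto_const_nhds.congr' ?_
      filter_upwards [hω.eventually_sqrt_smul_unit_sub_unit hα₀ hα₁ hdet hθ0] with n hn
      exact (sub_eq_zero.2 hn).symm

end Main

end LDA

theorem theorem1 {Ω : Type*} [MeasurableSpace Ω] (P : Measure Ω) [IsProbabilityMeasure P]
    {p : ℕ} (α₁ : unitInterval) (hα₀ : 0 < α₁) (hα₁ : α₁ < 1)
    (μ₁ μ₂ : EuclideanSpace ℝ (Fin p)) (hμ : μ₁ ≠ μ₂)
    (S : Matrix (Fin p) (Fin p) ℝ) (hS : S.PosDef)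
    (X : ℕ → Ω → EuclideanSpace ℝ (Fin p)) (Y : ℕ → Ω → ℝ)
    (hXY : LDA.IsSample P α₁ μ₁ μ₂ S X Y) :
    TendstoInDistribution
      (fun (n : ℕ) ω ↦ √(n : ℝ) •
        (LDA.unit (LDA.ldaEstimator n (fun i ↦ X i ω) (fun i ↦ Y i ω)) -
          LDA.unit (LDA.discriminant μ₁ μ₂ S)))
      atTop id (fun _ ↦ P) (multivariateGaussian 0 (LDA.limitCov (α₁ : ℝ) μ₁ μ₂ S)) := by
  exact hXY.tendstoInDistribution_direction (by exact_mod_cast hα₀) (by exact_mod_cast hα₁) hμ hS
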